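/- Let $\Gamma$ be a discrete group and let $A$ be a $C^*$-algebra with a continuous coaction $\alpha\colon A\to C^*_r(\Gamma)\otimes A$ of $C^*_r(\Gamma)$ (minimal tensor product): $\alpha$ is a $*$-homomorphism with $(\iota\otimes\alpha)\alpha=(\delta\otimes\iota)\alpha$, where $\delta(\lambda_g)=\lambda_g\otimes\lambda_g$, and $(C^*_r(\Gamma)\otimes 1)\alpha(A)$ spans a dense subspace of $C^*_r(\Gamma)\otimes A$. Let $\omega_0\colon\Gamma\times\Gamma\to\mathbb R$ be a normalized $2$-cocycle, that is, $\omega_0(g_0,g_1)+\omega_0(g_0g_1,g_2)=\omega_0(g_1,g_2)+\omega_0(g_0,g_1g_2)$ and $\omega_0(g,e)=\omega_0(e,g)=0$. Put $I=[0,1]$ and $\omega_\theta=e^{i\theta\omega_0}$ for $\theta\in I$. For a $\mathrm U(1)$-valued $2$-cocycle $\omega$, let $\lambda^{(\omega)}_g\delta_h=\omega(g,h)\delta_{gh}$ on $\ell^2(\Gamma)$ and let $C^*_{r,\omega}(\Gamma)$ be the $C^*$-algebra generated by the $\lambda^{(\omega)}_g$. Represent $A$ faithfully on a Hilbert space $K$.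 The braided tensor product $A\boxtimes C^*_{r,\omega}(\Gamma)$ is the $C^*$-algebra of operators on $\ell^2(\Gamma)\otimes K\otimes\ell^2(\Gamma)$ generated by the products $\alpha(a)_{12}\bigl(\sum_h\delta_h\otimes(\lambda^{(\omega)}_h)^*y\lambda^{(\omega)}_h\bigr)_{13}$ with $a\in A$, $y\in C^*_{r,\omega}(\Gamma)$; here $\delta_h$ also denotes the projection onto $\mathbb C\delta_h$. It carries the diagonal coaction, which acts on the factors by $\alpha(a)_{12}\mapsto(\delta\otimes\iota)(\alpha(a))_{123}$ and $\bigl(\sum_h\delta_h\otimes(\lambda^{(\omega)}_h)^*\lambda^{(\omega)}_g\lambda^{(\omega)}_h\bigr)_{13}\mapsto\lambda_g\otimes\bigl(\sum_h\delta_h\otimes(\lambda^{(\omega)}_h)^*\lambda^{(\omega)}_g\lambda^{(\omega)}_h\bigr)_{13}$. The deformation $A_\omega$ is the fixed point algebra of the diagonal coaction in $A\boxtimes C^*_{r,\overline\omega}(\Gamma)$. It carries the coaction $\alpha_\omega$ of $C^*_r(\Gamma)$ which acts by $\alpha(a)_{12}\mapsto(\delta\otimes\iota)(\alpha(a))_{123}$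 on the first factor and trivially on the second one. Let $C_0(\Gamma)\ltimes_{\alpha_\omega}A_\omega$ be the reduced crossed product, the $C^*$-algebra on $\ell^2(\Gamma)\otimes\ell^2(\Gamma)\otimes K\otimes\ell^2(\Gamma)$ generated by the products $\alpha_\omega(x)(\delta_h\otimes 1)$, $x\in A_\omega$, $h\in\Gamma$, and let $\hat\alpha_\omega$ be the dual action of $\Gamma$ on it, $(\hat\alpha_\omega)_k(\alpha_\omega(x)(\delta_h\otimes1))=\alpha_\omega(x)(\delta_{hk^{-1}}\otimes1)$. Carrying out the same constructions over $I$, that is, with $C^*_{r,\overline\omega}(\Gamma)$ replaced by the $C(I)$-algebra $C^*_{r,\overline\omega_\star}(\Gamma)$ of fields of operators generated by $C(I)$ and the fields $(\lambda^{(\overline\omega_{\theta'})}_g)_{\theta'\in I}$, $g\in\Gamma$ (with pointwise operations and the supremum norm), one obtains a $C(I)$-algebra $A_{\omega_\star}$, its crossed product $C_0(\Gamma)\ltimes_{\alpha_{\omega_\star}}A_{\omega_\star}$, and the dual action $\hat\alpha_\star$ of $\Gamma$ on the latter. Two actions $\gamma,\gamma'$ of a group $G$ on a $C^*$-algebra $D$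 are called exterior equivalent if there are unitaries $u_g\in M(D)$, $g\in G$, with $u_g\gamma_g(u_h)=u_{gh}$ and $\gamma'_g=\mathrm{Ad}_{u_g}\circ\gamma_g$ for all $g,h\in G$. An action $\gamma$ on $D$ and an action $\beta$ on $B$ are called outer conjugate if there is an isomorphism $\phi\colon B\to D$ such that $(\phi\beta_g\phi^{-1})_g$ is exterior equivalent to $\gamma$. **Proposition.** Let $H$ be a finite subgroup of $\Gamma$ and let $\theta\in I$. Then the restriction of $\hat\alpha_\star$ to $H$, on $C_0(\Gamma)\ltimes_{\alpha_{\omega_\star}}A_{\omega_\star}$, is outer conjugate to the restriction to $H$ of the constant field of the action $\hat\alpha_{\omega_\theta}$, that is, of the pointwise action on $C(I,\,C_0(\Gamma)\ltimes_{\alpha_{\omega_\theta}}A_{\omega_\theta})$; moreover, the isomorphism implementing the outer conjugacy can be taken $C(I)$-linear. -/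

import Mathlib

open scoped ENNReal unitInterval MultiplierAlgebra

noncomputable section

namespace CoactionDeformation

/-! ### Operators on `ℓ²(S) ⊗ E` -/

/-- The Hilbert space `ℓ²(S) ⊗ E`, realized as the square summable `E`-valued functions on `S`.
Iterated uses put the first tensor leg outermost: `ℓ²(S) ⊗ ℓ²(T) ⊗ E` is `Ell2 S (Ell2 T E)`. -/
abbrev Ell2 (S E : Type*) [NormedAddCommGroup E] : Type _ := lp (fun _ : S => E) 2

/-- The bounded operators on `E`. -/
abbrev Op (E : Type*) [NormedAddCommGroup E] [NormedSpace ℂ E] : Type _ := E →L[ℂ] E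

section Hilbert

variable {S T : Type*} {E : Type*} [NormedAddCommGroup E] [InnerProductSpace ℂ E]

lemma memlp_two_iff {F : Type*} [NormedAddCommGroup F] {f : S → F} :
    Memℓp f 2 ↔ Summable fun s => ‖f s‖ ^ 2 := by
  rw [memℓp_gen_iff (by norm_num)]
  simp

lemma norm_sq_eq_tsum {F : Type*} [NormedAddCommGroup F] (ξ : Ell2 S F) :
    ‖ξ‖ ^ 2 = ∑' s, ‖ξ s‖ ^ 2 := by
  have h := lp.norm_rpow_eq_tsum (p := 2) (by norm_num) ξ
  simpa using h

lemma summable_norm_sq {F : Type*} [NormedAddCommGroup F] (ξ : Ell2 S F) :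
    Summable fun s => ‖ξ s‖ ^ 2 := memlp_two_iff.1 (lp.memℓp ξ)

/-- The unitary `δ_s ⊗ η ↦ δ_{e s} ⊗ η` of `ℓ²(S) ⊗ E` given by a bijection `e` of `S`. -/
def permU (e : S ≃ S) : Ell2 S E ≃ₗᵢ[ℂ] Ell2 S E where
  toFun ξ := ⟨fun s => ξ (e.symm s), memlp_two_iff.2
    (e.symm.summable_iff (f := fun s => ‖ξ s‖ ^ 2) |>.2 (summable_norm_sq ξ))⟩
  invFun ξ := ⟨fun s => ξ (e s), memlp_two_iff.2
    (e.summable_iff (f := fun s => ‖ξ s‖ ^ 2) |>.2 (summable_norm_sq ξ))⟩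
  left_inv ξ := by ext s; simp
  right_inv ξ := by ext s; simp
  map_add' ξ η := by ext s; rfl
  map_smul' c ξ := by ext s; rfl
  norm_map' ξ := by
    rw [← sq_eq_sq₀ (norm_nonneg _) (norm_nonneg _), norm_sq_eq_tsum, norm_sq_eq_tsum]
    exact e.symm.tsum_eq (fun s => ‖ξ s‖ ^ 2)

/-- The unitary `∑_s δ_s ⊗ u_s` of `ℓ²(S) ⊗ E`, for a family of unitaries `u_s` of `E`. -/
def diagU (u : S → (E ≃ₗᵢ[ℂ] E)) : Ell2 S E ≃ₗᵢ[ℂ] Ell2 S E where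
  toFun ξ := ⟨fun s => u s (ξ s), memlp_two_iff.2 (by simpa using summable_norm_sq ξ)⟩
  invFun ξ := ⟨fun s => (u s).symm (ξ s), memlp_two_iff.2 (by simpa using summable_norm_sq ξ)⟩
  left_inv ξ := by ext s; simp
  right_inv ξ := by ext s; simp
  map_add' ξ η := by ext s; exact map_add (u s) _ _
  map_smul' c ξ := by ext s; exact map_smul (u s) _ _
  norm_map' ξ := by
    rw [← sq_eq_sq₀ (norm_nonneg _) (norm_nonneg _), norm_sq_eq_tsum, norm_sq_eq_tsum]
    simp

lemma summable_flip (ξ : Ell2 S (Ell2 T E)) :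
    Summable fun p : T × S => ‖ξ p.2 p.1‖ ^ 2 := by
  have h : Summable fun p : S × T => ‖ξ p.1 p.2‖ ^ 2 := by
    refine (summable_prod_of_nonneg (fun p => by positivity)).2 ⟨fun s => ?_, ?_⟩
    · exact summable_norm_sq (ξ s)
    · simpa only [← norm_sq_eq_tsum] using summable_norm_sq ξ
  exact (Equiv.prodComm T S).summable_iff (f := fun p : S × T => ‖ξ p.1 p.2‖ ^ 2) |>.2 h

lemma memlp_flip_inner (ξ : Ell2 S (Ell2 T E)) (t : T) : Memℓp (fun s => ξ s t) 2 :=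
  memlp_two_iff.2 (((summable_prod_of_nonneg (fun p => by positivity)).1 (summable_flip ξ)).1 t)

/-- The underlying function of the tensor flip. -/
def flipFun (ξ : Ell2 S (Ell2 T E)) : Ell2 T (Ell2 S E) :=
  ⟨fun t => ⟨fun s => ξ s t, memlp_flip_inner ξ t⟩, memlp_two_iff.2 (by
    simpa only [norm_sq_eq_tsum] using!
      ((summable_prod_of_nonneg (fun p => by positivity)).1 (summable_flip ξ)).2)⟩

lemma norm_flipFun (ξ : Ell2 S (Ell2 T E)) : ‖flipFun ξ‖ = ‖ξ‖ := by
  rw [← sq_eq_sq₀ (norm_nonneg _) (norm_nonneg _), norm_sq_eq_tsum, norm_sq_eq_tsum]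
  simp only [norm_sq_eq_tsum]
  exact (summable_flip ξ).tsum_comm.symm

/-- The tensor flip `ℓ²(S) ⊗ ℓ²(T) ⊗ E → ℓ²(T) ⊗ ℓ²(S) ⊗ E`. -/
def flipU : Ell2 S (Ell2 T E) ≃ₗᵢ[ℂ] Ell2 T (Ell2 S E) where
  toFun := flipFun
  invFun := flipFun
  left_inv _ := rfl
  right_inv _ := rfl
  map_add' _ _ := rfl
  map_smul' _ _ := rfl
  norm_map' ξ := norm_flipFun ξ

/-- The unitary of `E` given by multiplication by a scalar of modulus one. -/
def phaseU (z : Circle) : E ≃ₗᵢ[ℂ] E where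
  toFun ξ := (z : ℂ) • ξ
  invFun ξ := ((z⁻¹ : Circle) : ℂ) • ξ
  left_inv ξ := by simp [smul_smul]
  right_inv ξ := by simp [smul_smul]
  map_add' ξ η := smul_add _ _ _
  map_smul' c ξ := smul_comm _ _ _
  norm_map' ξ := by simpa [norm_smul] using! congrArg (· * ‖ξ‖) (Circle.norm_coe z)

variable (S) in
/-- The operator `1 ⊗ x` on `ℓ²(S) ⊗ E`. -/
def ampFun (x : Op E) : Op (Ell2 S E) :=
  LinearMap.mkContinuous
    { toFun := fun ξ => ⟨fun s => x (ξ s), memlp_two_iff.2 <| by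
        refine Summable.of_nonneg_of_le (fun s => by positivity) (fun s => ?_)
          ((summable_norm_sq ξ).mul_left (‖x‖ ^ 2))
        rw [← mul_pow]
        exact pow_le_pow_left₀ (norm_nonneg _) (x.le_opNorm _) 2⟩
      map_add' := fun ξ η => by ext s; exact map_add x _ _
      map_smul' := fun c ξ => by ext s; exact map_smul x _ _ } ‖x‖ (fun ξ => by
    rw [← sq_le_sq₀ (norm_nonneg _) (by positivity), norm_sq_eq_tsum, mul_pow, norm_sq_eq_tsum ξ,
      ← tsum_mul_left]
    have h : ∀ s, ‖x (ξ s)‖ ^ 2 ≤ ‖x‖ ^ 2 * ‖ξ s‖ ^ 2 := fun s => by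
      rw [← mul_pow]
      exact pow_le_pow_left₀ (norm_nonneg _) (x.le_opNorm _) 2
    exact Summable.tsum_le_tsum h
      (Summable.of_nonneg_of_le (fun s => by positivity) h
        ((summable_norm_sq ξ).mul_left (‖x‖ ^ 2)))
      ((summable_norm_sq ξ).mul_left (‖x‖ ^ 2)))

variable [CompleteSpace E]

variable (S E) in
/-- The homomorphism `x ↦ 1 ⊗ x` from the operators on `E` to those on `ℓ²(S) ⊗ E`. -/
def amp : Op E →⋆ₙₐ[ℂ] Op (Ell2 S E) where
  toFun := ampFun S
  map_smul' c x := rfl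
  map_zero' := rfl
  map_add' x y := rfl
  map_mul' x y := rfl
  map_star' x := by
    rw [ContinuousLinearMap.star_eq_adjoint, ContinuousLinearMap.star_eq_adjoint]
    refine (ContinuousLinearMap.eq_adjoint_iff _ _).2 fun ξ η => ?_
    rw [lp.inner_eq_tsum, lp.inner_eq_tsum]
    exact tsum_congr fun s => ContinuousLinearMap.adjoint_inner_left _ _ _

/-- The homomorphism `x ↦ V x V*` for a unitary `V` of `E`. -/
def conjHom (V : E ≃ₗᵢ[ℂ] E) : Op E →⋆ₙₐ[ℂ] Op E where
  toFun := V.conjStarAlgEquiv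
  map_smul' := map_smul V.conjStarAlgEquiv
  map_zero' := map_zero V.conjStarAlgEquiv
  map_add' := map_add V.conjStarAlgEquiv
  map_mul' := map_mul V.conjStarAlgEquiv
  map_star' := map_star V.conjStarAlgEquiv

open Classical in
/-- The projection `δ_s ⊗ 1` of `ℓ²(S) ⊗ E` onto the functions supported at `s`. -/
def deltaProj (s : S) : Op (Ell2 S E) :=
  (lp.singleContinuousLinearMap ℂ (fun _ : S => E) 2 s).comp (lp.evalCLM ℂ (fun _ : S => E) 2 s)

end Hilbert

/-! ### Group translations and the coproduct -/

section Group

variable {Γ : Type*} [Group Γ] {E : Type*} [NormedAddCommGroup E] [InnerProductSpace ℂ E]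

/-- `λ_g ⊗ 1` on `ℓ²(Γ) ⊗ E`, where `λ_g δ_h = δ_{gh}`. -/
def leftU (g : Γ) : Ell2 Γ E ≃ₗᵢ[ℂ] Ell2 Γ E := permU (Equiv.mulLeft g)

/-- `ρ_k ⊗ 1` on `ℓ²(Γ) ⊗ E`, where `ρ_k δ_h = δ_{h k⁻¹}`. -/
def rightU (k : Γ) : Ell2 Γ E ≃ₗᵢ[ℂ] Ell2 Γ E := permU (Equiv.mulRight k⁻¹)

/-- `λ^{(ω)}_g ⊗ 1` on `ℓ²(Γ) ⊗ E`, where `λ^{(ω)}_g δ_h = ω(g, h) δ_{gh}`. -/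
def twistedLeftU (ω : Γ → Γ → Circle) (g : Γ) : Ell2 Γ E ≃ₗᵢ[ℂ] Ell2 Γ E :=
  (diagU fun h => phaseU (ω g h)).trans (leftU g)

/-- The regular `ω`-representation unitary `W^{(ω)} = ∑_h δ_h ⊗ λ^{(ω)}_h ⊗ 1` on
`ℓ²(Γ) ⊗ ℓ²(Γ) ⊗ E`. -/
def regularU (ω : Γ → Γ → Circle) : Ell2 Γ (Ell2 Γ E) ≃ₗᵢ[ℂ] Ell2 Γ (Ell2 Γ E) :=
  diagU fun h => twistedLeftU ω h

/-- The unitary `U = ∑_h λ_h ⊗ δ_h ⊗ 1`, `δ_s ⊗ δ_h ⊗ η ↦ δ_{hs} ⊗ δ_h ⊗ η`, on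
`ℓ²(Γ) ⊗ ℓ²(Γ) ⊗ E`. -/
def coprodU : Ell2 Γ (Ell2 Γ E) ≃ₗᵢ[ℂ] Ell2 Γ (Ell2 Γ E) :=
  (flipU (S := Γ) (T := Γ) (E := E)).trans
    ((diagU fun h : Γ => leftU (E := E) h).trans (flipU (S := Γ) (T := Γ) (E := E)))

variable [CompleteSpace E]

/-- `λ_g ⊗ x` on `ℓ²(Γ) ⊗ E`. -/
def lamTensor (g : Γ) (x : Op E) : Op (Ell2 Γ E) :=
  (leftU g : Ell2 Γ E ≃ₗᵢ[ℂ] Ell2 Γ E).toContinuousLinearEquiv.toContinuousLinearMap *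
    amp Γ E x

variable (Γ E) in
/-- The homomorphism `x ↦ U (1 ⊗ x) U*` from operators on `ℓ²(Γ) ⊗ E` to operators on
`ℓ²(Γ) ⊗ ℓ²(Γ) ⊗ E`; it sends `λ_g ⊗ y` to `λ_g ⊗ λ_g ⊗ y`, so that it restricts to `δ ⊗ ι`. -/
def coprodHom : Op (Ell2 Γ E) →⋆ₙₐ[ℂ] Op (Ell2 Γ (Ell2 Γ E)) :=
  (conjHom (coprodU (Γ := Γ) (E := E))).comp (amp Γ (Ell2 Γ E))

end Group

/-! ### `C*`-algebras generated by a set, and restriction of actions -/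

section Generated

variable {F : Type*} [NonUnitalCStarAlgebra F]

/-- The `C*`-subalgebra generated by a subset of a `C*`-algebra. -/
def cstarGen (s : Set F) : NonUnitalStarSubalgebra ℂ F :=
  (NonUnitalStarAlgebra.adjoin ℂ s).topologicalClosure

instance isClosed_cstarGen (s : Set F) : IsClosed (cstarGen s : Set F) :=
  NonUnitalStarSubalgebra.isClosed_topologicalClosure _

/-- The `C*`-subalgebra generated by a subset, as a `C*`-algebra in its own right. -/
def CStarGen (s : Set F) : Type _ := cstarGen s

instance (s : Set F) : NonUnitalCStarAlgebra (CStarGen s) :=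
  inferInstanceAs (NonUnitalCStarAlgebra (cstarGen s))

/-- The inclusion of the `C*`-subalgebra generated by a subset. -/
def CStarGen.incl (s : Set F) : CStarGen s →⋆ₙₐ[ℂ] F where
  toFun x := x.1
  map_smul' _ _ := rfl
  map_zero' := rfl
  map_add' _ _ := rfl
  map_mul' _ _ := rfl
  map_star' _ := rfl

lemma subset_cstarGen (s : Set F) : s ⊆ cstarGen s :=
  (NonUnitalStarAlgebra.subset_adjoin ℂ s).trans
    (NonUnitalStarSubalgebra.le_topologicalClosure _)

lemma map_mem_cstarGen {s : Set F} (ψ : F ≃⋆ₐ[ℂ] F) (h : ∀ x ∈ s, ψ x ∈ s) {x : F}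
    (hx : x ∈ cstarGen s) : ψ x ∈ cstarGen s := by
  have hc : Continuous ψ := (StarAlgEquiv.isometry ψ).continuous
  have key : cstarGen s ≤ (cstarGen s).comap (ψ : F →⋆ₙₐ[ℂ] F) := by
    refine NonUnitalStarSubalgebra.topologicalClosure_minimal _ ?_ ?_
    · exact NonUnitalStarAlgebra.adjoin_le fun y hy => subset_cstarGen s (h y hy)
    · exact (isClosed_cstarGen s).preimage hc
  exact key hx

/-- The action on the `C*`-subalgebra generated by an invariant set, obtained by restriction. -/
def restrictAction {G : Type*} [Group G] (Θ : G →* (F ≃⋆ₐ[ℂ] F)) (s : Set F)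
    (h : ∀ g, ∀ x ∈ s, Θ g x ∈ s) : G →* (CStarGen s ≃⋆ₐ[ℂ] CStarGen s) where
  toFun g :=
    { toFun := fun x => ⟨Θ g x.1, map_mem_cstarGen (Θ g) (h g) x.2⟩
      invFun := fun x => ⟨Θ g⁻¹ x.1, map_mem_cstarGen (Θ g⁻¹) (h g⁻¹) x.2⟩
      left_inv := fun x => Subtype.ext <| by
        change Θ g⁻¹ (Θ g x.1) = x.1
        rw [← StarAlgEquiv.mul_apply, ← map_mul, inv_mul_cancel, map_one, StarAlgEquiv.one_apply]
      right_inv := fun x => Subtype.ext <| by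
        change Θ g (Θ g⁻¹ x.1) = x.1
        rw [← StarAlgEquiv.mul_apply, ← map_mul, mul_inv_cancel, map_one, StarAlgEquiv.one_apply]
      map_mul' := fun x y => Subtype.ext <| map_mul (Θ g) x.1 y.1
      map_add' := fun x y => Subtype.ext <| map_add (Θ g) x.1 y.1
      map_star' := fun x => Subtype.ext <| map_star (Θ g) x.1
      map_smul' := fun c x => Subtype.ext <| map_smul (Θ g) c x.1 }
  map_one' := StarAlgEquiv.ext fun x => Subtype.ext <| by
    change Θ 1 x.1 = x.1
    rw [map_one, StarAlgEquiv.one_apply]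
  map_mul' g g' := StarAlgEquiv.ext fun x => Subtype.ext <| by
    change Θ (g * g') x.1 = Θ g (Θ g' x.1)
    rw [map_mul, StarAlgEquiv.mul_apply]

end Generated

/-! ### Coactions of `C*_r(Γ)` -/

section Coaction

variable (Γ : Type*) [Group Γ] {A : Type*} [NonUnitalCStarAlgebra A]
  {K : Type*} [NormedAddCommGroup K] [InnerProductSpace ℂ K] [CompleteSpace K]

/-- The minimal (spatial) tensor product `C*_r(Γ) ⊗ A`, formed on `ℓ²(Γ) ⊗ K` by means of a
representation `π` of `A` on `K`. -/
abbrev spatialTensor (π : A →⋆ₙₐ[ℂ] Op K) : NonUnitalStarSubalgebra ℂ (Op (Ell2 Γ K)) :=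
  cstarGen {y | ∃ (g : Γ) (a : A), y = lamTensor g (π a)}

variable {Γ}

lemma lamTensor_mem (π : A →⋆ₙₐ[ℂ] Op K) (g : Γ) (a : A) :
    lamTensor g (π a) ∈ spatialTensor Γ π :=
  subset_cstarGen _ ⟨g, a, rfl⟩

variable (Γ)

/-- A continuous coaction of `C*_r(Γ)` on `A`: a homomorphism `α : A → C*_r(Γ) ⊗ A` with
`(ι ⊗ α) ∘ α = (δ ⊗ ι) ∘ α` and such that `(C*_r(Γ) ⊗ 1) α(A)` spans a dense subspace of
`C*_r(Γ) ⊗ A`. In `coassoc` the homomorphism `F` is `ι ⊗ α` on `C*_r(Γ) ⊗ A`; it always exists and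
is determined by its values on the generators `λ_g ⊗ a`. -/
structure Coaction (π : A →⋆ₙₐ[ℂ] Op K) where
  toHom : A →⋆ₙₐ[ℂ] Op (Ell2 Γ K)
  mem_tensor : ∀ a, toHom a ∈ spatialTensor Γ π
  coassoc : ∃ F : spatialTensor Γ π →⋆ₙₐ[ℂ] Op (Ell2 Γ (Ell2 Γ K)),
    (∀ (g : Γ) (a : A), F ⟨lamTensor g (π a), lamTensor_mem π g a⟩ = lamTensor g (toHom a)) ∧
    ∀ a : A, F ⟨toHom a, mem_tensor a⟩ = coprodHom Γ K (toHom a)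
  cancellation : closure (Submodule.span ℂ
      {y : Op (Ell2 Γ K) | ∃ (g : Γ) (a : A),
        y = (leftU g : Ell2 Γ K ≃ₗᵢ[ℂ] Ell2 Γ K).toContinuousLinearEquiv.toContinuousLinearMap *
          toHom a} : Set (Op (Ell2 Γ K))) = spatialTensor Γ π

end Coaction

/-! ### Fields of operators -/

section Fields

variable (X : Type*) (E : Type*) [NormedAddCommGroup E] [InnerProductSpace ℂ E] [CompleteSpace E]

/-- The `C*`-algebra of bounded fields `(T_x)_{x ∈ X}` of operators on `E`, with pointwise
operations and the supremum norm. -/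
def Fld : Type _ := lp (fun _ : X => Op E) ∞

instance : NonUnitalCStarAlgebra (Fld X E) :=
  inferInstanceAs (NonUnitalCStarAlgebra (lp (fun _ : X => Op E) ∞))

variable {X E}

instance : CoeFun (Fld X E) fun _ => X → Op E := ⟨fun T => T.1⟩

@[ext] lemma Fld.ext {T T' : Fld X E} (h : ∀ x, T x = T' x) : T = T' :=
  lp.ext (funext h)

/-- The field with the given values, for a uniformly bounded family. -/
def mkFld (T : X → Op E) (C : ℝ) (h : ∀ x, ‖T x‖ ≤ C) : Fld X E :=
  ⟨T, memℓp_infty ⟨C, by rintro _ ⟨x, rfl⟩; exact h x⟩⟩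

/-- The constant field. -/
def constFld (T : Op E) : Fld X E := mkFld (fun _ => T) ‖T‖ fun _ => le_rfl

/-- The field of unitaries `(u_x)_x`. -/
def unitaryFld (u : X → (E ≃ₗᵢ[ℂ] E)) : Fld X E :=
  mkFld (fun x => (u x).toContinuousLinearEquiv.toContinuousLinearMap) 1 fun x =>
    (u x).toLinearIsometry.norm_toContinuousLinearMap_le

/-- The field `(f(x) 1)_x` given by a continuous function `f` on `X`. -/
def scalarFld [TopologicalSpace X] [CompactSpace X] (f : C(X, ℂ)) : Fld X E :=
  mkFld (fun x => f x • (1 : Op E)) ‖f‖ fun x => by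
    rw [norm_smul]
    exact (mul_le_of_le_one_right (norm_nonneg _) ContinuousLinearMap.norm_id_le).trans
      (f.norm_coe_le_norm x)

variable {E' : Type*} [NormedAddCommGroup E'] [InnerProductSpace ℂ E'] [CompleteSpace E']

/-- Pointwise application of a family of homomorphisms to a field. -/
def fldMap (Ψ : X → (Op E →⋆ₙₐ[ℂ] Op E')) : Fld X E →⋆ₙₐ[ℂ] Fld X E' where
  toFun T := mkFld (fun x => Ψ x (T x)) ‖T‖ fun x =>
    (NonUnitalStarAlgHom.norm_apply_le (Ψ x) (T x)).trans
      (lp.norm_apply_le_norm (E := fun _ : X => Op E) ENNReal.top_ne_zero T x)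
  map_smul' c T := Fld.ext fun x => by exact map_smul (Ψ x) c (T x)
  map_zero' := Fld.ext fun x => by exact map_zero (Ψ x)
  map_add' T T' := Fld.ext fun x => by exact map_add (Ψ x) (T x) (T' x)
  map_mul' T T' := Fld.ext fun x => by exact map_mul (Ψ x) (T x) (T' x)
  map_star' T := Fld.ext fun x => by exact map_star (Ψ x) (T x)

@[simp] lemma fldMap_apply (Ψ : X → (Op E →⋆ₙₐ[ℂ] Op E')) (T : Fld X E) (x : X) :
    fldMap Ψ T x = Ψ x (T x) := rfl

lemma conjHom_mul (V V' : E ≃ₗᵢ[ℂ] E) (T : Op E) :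
    conjHom (V * V') T = conjHom V (conjHom V' T) := rfl

lemma conjHom_one (T : Op E) : conjHom (1 : E ≃ₗᵢ[ℂ] E) T = T := rfl

variable (X) in
lemma fldMap_conj_mul (V V' : E ≃ₗᵢ[ℂ] E) (T : Fld X E) :
    fldMap (fun _ => conjHom (V * V')) T =
      fldMap (fun _ => conjHom V) (fldMap (fun _ => conjHom V') T) := by
  refine Fld.ext fun x => ?_
  simp only [fldMap_apply, conjHom_mul]

variable (X) in
lemma fldMap_conj_one (T : Fld X E) : fldMap (fun _ => conjHom (1 : E ≃ₗᵢ[ℂ] E)) T = T := by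
  refine Fld.ext fun x => ?_
  simp only [fldMap_apply, conjHom_one]

variable (X E) in
/-- The action `(T_x)_x ↦ (V T_x V*)_x` of the unitary group of `E` on the fields. -/
def fldConj : (E ≃ₗᵢ[ℂ] E) →* (Fld X E ≃⋆ₐ[ℂ] Fld X E) where
  toFun V :=
    { toFun := fldMap fun _ => conjHom V
      invFun := fldMap fun _ => conjHom V⁻¹
      left_inv := fun T => by rw [← fldMap_conj_mul, inv_mul_cancel, fldMap_conj_one]
      right_inv := fun T => by rw [← fldMap_conj_mul, mul_inv_cancel, fldMap_conj_one]
      map_mul' := map_mul _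
      map_add' := map_add _
      map_star' := map_star _
      map_smul' := map_smul _ }
  map_one' := StarAlgEquiv.ext fun T => fldMap_conj_one X T
  map_mul' V V' := StarAlgEquiv.ext fun T => fldMap_conj_mul X V V' T

end Fields

/-! ### Deformation by a family of cocycles, over a compact parameter space -/

section Deformation

variable {Γ : Type*} [Group Γ] {A : Type*} [NonUnitalCStarAlgebra A]
  {K : Type*} [NormedAddCommGroup K] [InnerProductSpace ℂ K] [CompleteSpace K]
  {π : A →⋆ₙₐ[ℂ] Op K} {X : Type*} [TopologicalSpace X] [CompactSpace X]

variable (K) in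
/-- The twisted group algebra `C*_{r,ω}(Γ)` over `X` for a family `ω = (ω_x)_x` of cocycles,
generated by the fields `λ^{(ω)}_g = (λ^{(ω_x)}_g)_x` and by `C(X)`. It acts on `ℓ²(Γ) ⊗ K` through
the first leg. For a one-point space `X` this is the usual twisted reduced group algebra. -/
abbrev twistedGroupAlg (ω : X → Γ → Γ → Circle) : NonUnitalStarSubalgebra ℂ (Fld X (Ell2 Γ K)) :=
  cstarGen ({y | ∃ g : Γ, y = unitaryFld fun x => twistedLeftU (ω x) g} ∪
    {y | ∃ f : C(X, ℂ), y = scalarFld f})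

/-- The operator `α(a)_{12}` on `ℓ²(Γ)₁ ⊗ K₂ ⊗ ℓ²(Γ)₃`. This space is realized with its legs in the
order `1, 3, 2`, as `Ell2 Γ (Ell2 Γ K)`. -/
def coaction12 (α : Coaction Γ π) (a : A) : Op (Ell2 Γ (Ell2 Γ K)) :=
  conjHom (flipU (S := Γ) (T := Γ) (E := K)) (amp Γ (Ell2 Γ K) (α.toHom a))

variable (Γ K) in
/-- The field `(∑_h δ_h ⊗ Ad_{h⁻¹}(y_x))_x = W* (1 ⊗ y) W` in legs `1, 3`, where
`Ad_g` is conjugation by `λ^{(ω_x)}_g` and `W` is the regular `ω_x`-representation unitary. -/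
def adjointCoaction (ω : X → Γ → Γ → Circle) :
    Fld X (Ell2 Γ K) →⋆ₙₐ[ℂ] Fld X (Ell2 Γ (Ell2 Γ K)) :=
  fldMap fun x => (conjHom (regularU (E := K) (ω x)).symm).comp (amp Γ (Ell2 Γ K))

/-- The braided tensor product `A ⊠ C*_{r,ω}(Γ)` over `X`, generated by the products
`α(a)_{12} (∑_h δ_h ⊗ Ad_{h⁻¹}(y))_{13}` for `a` in `A` and `y` in `C*_{r,ω}(Γ)`. -/
abbrev braidedTensor (α : Coaction Γ π) (ω : X → Γ → Γ → Circle) :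
    NonUnitalStarSubalgebra ℂ (Fld X (Ell2 Γ (Ell2 Γ K))) :=
  cstarGen {z | ∃ (a : A) (y : twistedGroupAlg K ω),
    z = constFld (coaction12 α a) * adjointCoaction Γ K ω y}

variable (Γ K) in
/-- The unitary `δ_s ⊗ δ_h ⊗ δ_t ⊗ η ↦ δ_{hts} ⊗ δ_h ⊗ δ_t ⊗ η` on
`ℓ²(Γ) ⊗ ℓ²(Γ)₁ ⊗ ℓ²(Γ)₃ ⊗ K₂`. -/
def diagonalU : Ell2 Γ (Ell2 Γ (Ell2 Γ K)) ≃ₗᵢ[ℂ] Ell2 Γ (Ell2 Γ (Ell2 Γ K)) :=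
  (((flipU (S := Γ) (T := Γ) (E := Ell2 Γ K)).trans
    (diagU fun _ : Γ => coprodU (Γ := Γ) (E := K))).trans
    (flipU (S := Γ) (T := Γ) (E := Ell2 Γ K))).trans (coprodU (Γ := Γ) (E := Ell2 Γ K))

variable (Γ K) in
/-- The diagonal coaction of `C*_r(Γ)` on the braided tensor product, `z ↦ T (1 ⊗ z) T*` with the
unitary `T` above. On the generators it is given by
`α(a)_{12} ↦ (δ ⊗ ι)(α(a))` and `(∑_h δ_h ⊗ Ad_{h⁻¹}(λ_g)) ↦ λ_g ⊗ (∑_h δ_h ⊗ Ad_{h⁻¹}(λ_g))`. -/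
def diagonalCoaction (X : Type*) :
    Fld X (Ell2 Γ (Ell2 Γ K)) →⋆ₙₐ[ℂ] Fld X (Ell2 Γ (Ell2 Γ (Ell2 Γ K))) :=
  fldMap fun _ => (conjHom (diagonalU Γ K)).comp (amp Γ (Ell2 Γ (Ell2 Γ K)))

/-- The deformation `A_ω` over `X`: the fixed point algebra of the diagonal coaction in
`A ⊠ C*_{r,ω̄}(Γ)`. -/
def deformation (α : Coaction Γ π) (ω : X → Γ → Γ → Circle) :
    NonUnitalStarSubalgebra ℂ (Fld X (Ell2 Γ (Ell2 Γ K))) :=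
  braidedTensor α (fun x g h => (ω x g h)⁻¹) ⊓
    NonUnitalStarAlgHom.equalizer (diagonalCoaction Γ K X)
      (fldMap fun _ => amp Γ (Ell2 Γ (Ell2 Γ K)))

variable (Γ K) in
/-- The coaction `α_ω` of `C*_r(Γ)` on `A_ω`, acting as `α` on the first factor of
`A ⊠ C*_{r,ω̄}(Γ)` and trivially on the second one. -/
def deformedCoaction (X : Type*) :
    Fld X (Ell2 Γ (Ell2 Γ K)) →⋆ₙₐ[ℂ] Fld X (Ell2 Γ (Ell2 Γ (Ell2 Γ K))) :=
  fldMap fun _ => coprodHom Γ (Ell2 Γ K)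

/-- The elements `α_ω(b) (δ_h ⊗ 1)` for `b` in `A_ω` and `h` in `Γ`. -/
def crossedGenerators (α : Coaction Γ π) (ω : X → Γ → Γ → Circle) :
    Set (Fld X (Ell2 Γ (Ell2 Γ (Ell2 Γ K)))) :=
  {z | ∃ b ∈ deformation α ω, ∃ h : Γ,
    z = deformedCoaction Γ K X b * constFld (deltaProj h)}

/-- The crossed product `C₀(Γ) ⋉ A_ω` with respect to `α_ω`. -/
abbrev CrossedProduct (α : Coaction Γ π) (ω : X → Γ → Γ → Circle) : Type _ :=
  CStarGen (crossedGenerators α ω)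

section DualAction

variable {E : Type*} [NormedAddCommGroup E] [InnerProductSpace ℂ E] [CompleteSpace E]

lemma conj_rightU_coprodHom (k : Γ) (x : Op (Ell2 Γ E)) :
    conjHom (rightU k) (coprodHom Γ E x) = coprodHom Γ E x := by
  have h1 : ∀ ξ : Ell2 Γ (Ell2 Γ E), rightU k (coprodU ξ) = coprodU (rightU k ξ) := fun ξ => by
    ext s t
    exact congrArg (fun r => ξ r t) (mul_assoc t⁻¹ s (k⁻¹)⁻¹).symm
  have h2 : ∀ ξ : Ell2 Γ (Ell2 Γ E), rightU k (coprodU.symm ξ) = coprodU.symm (rightU k ξ) :=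
    fun ξ => by
      rw [LinearIsometryEquiv.eq_symm_apply, ← h1, LinearIsometryEquiv.apply_symm_apply]
  refine ContinuousLinearMap.ext fun ξ => ?_
  change rightU k (coprodU (amp Γ (Ell2 Γ E) x (coprodU.symm ((rightU k).symm ξ)))) =
    coprodU (amp Γ (Ell2 Γ E) x (coprodU.symm ξ))
  have h3 : ∀ η : Ell2 Γ (Ell2 Γ E),
    rightU k (amp Γ (Ell2 Γ E) x η) = amp Γ (Ell2 Γ E) x (rightU k η) := fun η => rfl
  rw [h1, h3, h2, LinearIsometryEquiv.apply_symm_apply]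

lemma conj_rightU_deltaProj (k h : Γ) :
    conjHom (rightU k) (deltaProj h : Op (Ell2 Γ E)) = deltaProj (h * k⁻¹) := by
  classical
  refine ContinuousLinearMap.ext fun ξ => lp.ext <| funext fun s => ?_
  change lp.single (E := fun _ : Γ => E) 2 h (ξ ((Equiv.mulRight k⁻¹) h))
      ((Equiv.mulRight k⁻¹).symm s) =
    lp.single (E := fun _ : Γ => E) 2 (h * k⁻¹) (ξ (h * k⁻¹)) s
  by_cases hs : s = h * k⁻¹
  · subst hs
    have : (Equiv.mulRight k⁻¹).symm (h * k⁻¹) = h := by simp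
    rw [this, lp.single_apply_self, lp.single_apply_self]
    rfl
  · have : (Equiv.mulRight k⁻¹).symm s ≠ h := fun e => hs (by simp [← e])
    rw [lp.single_apply_ne _ _ _ this, lp.single_apply_ne _ _ _ hs]

end DualAction

lemma rightU_crossedGenerators (α : Coaction Γ π) (ω : X → Γ → Γ → Circle) (k : Γ)
    (z : Fld X (Ell2 Γ (Ell2 Γ (Ell2 Γ K)))) (hz : z ∈ crossedGenerators α ω) :
    fldConj X _ (rightU k) z ∈ crossedGenerators α ω := by
  obtain ⟨b, hb, h, rfl⟩ := hz
  refine ⟨b, hb, h * k⁻¹, ?_⟩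
  rw [map_mul]
  congr 1
  · refine Fld.ext fun x => ?_
    exact conj_rightU_coprodHom k (b x)
  · refine Fld.ext fun x => ?_
    exact conj_rightU_deltaProj k h

variable (Γ) in
/-- The right translations as a representation of `Γ`. -/
def rightRep (E : Type*) [NormedAddCommGroup E] [InnerProductSpace ℂ E] :
    Γ →* (Ell2 Γ E ≃ₗᵢ[ℂ] Ell2 Γ E) where
  toFun := rightU
  map_one' := by ext ξ s; simp [rightU, permU]
  map_mul' k k' := by ext ξ s; simp [rightU, permU, mul_assoc]

/-- The dual action of `Γ` on `C₀(Γ) ⋉ A_ω`, which fixes `α_ω(A_ω)` and sends `δ_h` to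
`δ_{h k⁻¹}`; it is implemented by the right translations. -/
def dualAction (α : Coaction Γ π) (ω : X → Γ → Γ → Circle) :
    Γ →* (CrossedProduct α ω ≃⋆ₐ[ℂ] CrossedProduct α ω) :=
  restrictAction ((fldConj X _).comp (rightRep Γ (Ell2 Γ (Ell2 Γ K)))) _
    (rightU_crossedGenerators α ω)

end Deformation

/-! ### Exterior equivalence and outer conjugacy -/

section Exterior

variable {D B : Type*} [NonUnitalCStarAlgebra D] [NonUnitalCStarAlgebra B]
  {G : Type*} [Group G]

/-- An automorphism as a bounded linear map. -/
def autCLM (ψ : D ≃⋆ₐ[ℂ] D) : D →L[ℂ] D where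
  toFun := ψ
  map_add' := map_add ψ
  map_smul' := map_smul ψ
  cont := (StarAlgEquiv.isometry ψ).continuous

/-- The extension of an automorphism of `D` to the multiplier algebra `M(D)`. -/
def multiplierMap (ψ : D ≃⋆ₐ[ℂ] D) (m : 𝓜(ℂ, D)) : 𝓜(ℂ, D) where
  fst := (autCLM ψ).comp (m.fst.comp (autCLM ψ.symm))
  snd := (autCLM ψ).comp (m.snd.comp (autCLM ψ.symm))
  central x y := by
    simpa [autCLM] using congrArg ψ (m.central (ψ.symm x) (ψ.symm y))

/-- Two actions `γ` and `γ'` of `G` on `D` are exterior equivalent if there are unitaries `u_g` in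
`M(D)` with `u_g γ_g(u_h) = u_{gh}` and `γ'_g = Ad(u_g) ∘ γ_g`. -/
def ExteriorEquivalent (γ γ' : G →* (D ≃⋆ₐ[ℂ] D)) : Prop :=
  ∃ u : G → unitary 𝓜(ℂ, D),
    (∀ g h, (u g : 𝓜(ℂ, D)) * multiplierMap (γ g) (u h) = u (g * h)) ∧
    ∀ g d, ((γ' g d : D) : 𝓜(ℂ, D)) = u g * ((γ g d : D) : 𝓜(ℂ, D)) * star (u g : 𝓜(ℂ, D))

/-- The transport `g ↦ φ β_g φ⁻¹` of an action along an isomorphism `φ`. -/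
def transportAction (φ : B ≃⋆ₐ[ℂ] D) (β : G →* (B ≃⋆ₐ[ℂ] B)) : G →* (D ≃⋆ₐ[ℂ] D) where
  toFun g := (φ.symm.trans (β g)).trans φ
  map_one' := by ext d; simp
  map_mul' g h := by ext d; simp

/-- The constant field, over `X`, of an action on `B`: the pointwise action on `C(X, B)`. -/
def constantAction (X : Type*) [TopologicalSpace X] [CompactSpace X] (β : G →* (B ≃⋆ₐ[ℂ] B)) :
    G →* (C(X, B) ≃⋆ₐ[ℂ] C(X, B)) where
  toFun g :=
    { toFun := fun f => ⟨fun x => β g (f x),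
        (StarAlgEquiv.isometry (β g)).continuous.comp f.continuous⟩
      invFun := fun f => ⟨fun x => β g⁻¹ (f x),
        (StarAlgEquiv.isometry (β g⁻¹)).continuous.comp f.continuous⟩
      left_inv := fun f => by ext x; simp [← StarAlgEquiv.mul_apply, ← map_mul, - map_inv]
      right_inv := fun f => by ext x; simp [← StarAlgEquiv.mul_apply, ← map_mul, - map_inv]
      map_mul' := fun f f' => by ext x; exact map_mul (β g) _ _
      map_add' := fun f f' => by ext x; exact map_add (β g) _ _
      map_star' := fun f => by ext x; exact map_star (β g) _
      map_smul' := fun c f => by ext x; exact map_smul (β g) _ _ }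
  map_one' := by ext f x; simp
  map_mul' g h := by ext f x; simp

end Exterior

/-! ### Real cocycles -/

/-- A normalized `ℝ`-valued `2`-cocycle on `Γ`. -/
structure RealCocycle (Γ : Type*) [Group Γ] where
  toFun : Γ → Γ → ℝ
  cocycle : ∀ g₀ g₁ g₂,
    toFun g₀ g₁ + toFun (g₀ * g₁) g₂ = toFun g₁ g₂ + toFun g₀ (g₁ * g₂)
  apply_one : ∀ g, toFun g 1 = 0
  one_apply : ∀ g, toFun 1 g = 0

/-- The `U(1)`-valued cocycle `ω_θ = e^{i θ ω₀}`. -/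
def RealCocycle.twist {Γ : Type*} [Group Γ] (ω₀ : RealCocycle Γ) (θ : ℝ) : Γ → Γ → Circle :=
  fun g h => Circle.exp (θ * ω₀.toFun g h)

end CoactionDeformation

end

set_option linter.unusedSectionVars false

noncomputable section

namespace CoactionDeformation

/-! ### Generated `C*`-algebras and closed spans -/

section Generated

/-! After a suitable unitary conjugation the crossed product no longer depends on the cocycle, so
only the dual action remembers it, and it does so through phases that become a removable coboundary
on a finite subgroup.

Coassociativity and the density condition make `A` the closed span of its spectral subspaces `A_g =
{a | α(a) = λ_g ⊗ a}` (`mem_closedSpan_spectral`). Put `τ = ω̄`. Conjugation by the regular unitary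
`W^{(τ)}` turns the generators of the braided tensor product into multiples of `λ^{(ω)}_g ⊗
λ^{(τ)}_k ⊗ a` with `a ∈ A_g` (`fldAd_regularU_generator`). Such an element has degree `k` for the
diagonal coaction and `g` for `α_ω`. Hence `A_ω` is the closed span of the elements with `k = 1`
(`fldAd_deformation_mem`, `fldAd_symm_mem_deformation`), and the crossed product is generated by
`λ_g δ_s ⊗ λ^{(ω)}_g ⊗ 1 ⊗ a`. A second conjugation, by `(W^{(ω)}_{01})*`, changes these into
`ω(g,s) e_{gs,s} ⊗ 1 ⊗ 1 ⊗ a` (`fldAd_untwistU_generator`). As the phase depends continuously on the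
parameter, the `C*`-algebra `cstarGen (matrixFields X α)` obtained over `X` is the same for every
continuous family `ω`. This gives the isomorphism `trivialization`.

In this picture the dual action at `k` multiplies `e_{p,q} ⊗ a`, after translating the indices, by
`ω̄(p,k) ω(q,k)` (`twistedRightU_matrixOp`). The actions for `ω_θ` and `ω_t` therefore differ by
conjugation with a diagonal unitary whose entries are `exp(-i(θ-t) ω₀(s,k))`, up to a factor
independent of `s`. These unitaries satisfy the cocycle identity only up to `exp(-i(θ-t) ω₀(k,h))`.
On a finite subgroup `ω₀` is a real coboundary (`RealCocycle.exists_coboundary`), and its primitive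
`ψ` supplies the factor `exp(i(θ-t) ψ(k))` that repairs the identity. -/

lemma map_mem_of_mem_closedSpan {E F : Type*} [AddCommGroup E] [Module ℂ E]
    [TopologicalSpace E] [ContinuousAdd E] [ContinuousConstSMul ℂ E]
    [AddCommGroup F] [Module ℂ F] [TopologicalSpace F] [IsTopologicalAddGroup F] [T1Space F]
    (L : E →L[ℂ] F) {s : Set E} {p : Submodule ℂ F}
    (hp : IsClosed (p : Set F)) (h : ∀ x ∈ s, L x ∈ p) {x : E}
    (hx : x ∈ (Submodule.span ℂ s).topologicalClosure) : L x ∈ p := by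
  have key : (Submodule.span ℂ s).topologicalClosure ≤ p.comap (L : E →ₗ[ℂ] F) :=
    Submodule.topologicalClosure_minimal _ (Submodule.span_le.2 h) (hp.preimage L.continuous)
  exact key hx

lemma eqOn_closedSpan {E F : Type*} [AddCommGroup E] [Module ℂ E]
    [TopologicalSpace E] [ContinuousAdd E] [ContinuousConstSMul ℂ E]
    [AddCommGroup F] [Module ℂ F] [TopologicalSpace F] [IsTopologicalAddGroup F] [T1Space F]
    (L L' : E →L[ℂ] F) {s : Set E}
    (h : ∀ x ∈ s, L x = L' x) {x : E}
    (hx : x ∈ (Submodule.span ℂ s).topologicalClosure) : L x = L' x := by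
  have := map_mem_of_mem_closedSpan (L - L') (p := ⊥) isClosed_singleton
    (fun x hx => by simp [h x hx]) hx
  simpa [sub_eq_zero] using this

/-- Needed for the homomorphism `ι ⊗ α`, which is only defined on `C*_r(Γ) ⊗ A`: the closure has to
be taken inside the subspace. -/
lemma eqOn_subtype_of_mem_closedSpan {E F : Type*} [AddCommGroup E] [Module ℂ E]
    [TopologicalSpace E] [IsTopologicalAddGroup E] [ContinuousSMul ℂ E]
    [AddCommGroup F] [Module ℂ F] [TopologicalSpace F] [IsTopologicalAddGroup F] [T1Space F]
    {s : Set E} {C : Submodule ℂ E} (hs : s ⊆ C) (L L' : C →L[ℂ] F)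
    (h : ∀ x (hx : x ∈ s), L ⟨x, hs hx⟩ = L' ⟨x, hs hx⟩) (T : C)
    (hT : T.1 ∈ (Submodule.span ℂ s).topologicalClosure) : L T = L' T := by
  refine eqOn_closedSpan L L' (s := (Subtype.val ⁻¹' s : Set C)) (fun x hx => h x.1 hx) ?_
  change T ∈ closure ((Submodule.span ℂ (Subtype.val ⁻¹' s : Set C) : Submodule ℂ C) : Set C)
  rw [Topology.IsInducing.subtypeVal.closure_eq_preimage_closure_image, Set.mem_preimage]
  have h2 : s = C.subtype '' (Subtype.val ⁻¹' s : Set C) := by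
    ext y
    exact ⟨fun hy => ⟨⟨y, hs hy⟩, hy, rfl⟩, by rintro ⟨x, hx, rfl⟩; exact hx⟩
  rw [h2, Submodule.span_image] at hT
  exact hT

variable {F : Type*} [NonUnitalCStarAlgebra F]

lemma cstarGen_le {s : Set F} {C : NonUnitalStarSubalgebra ℂ F} (hC : IsClosed (C : Set F))
    (h : s ⊆ C) : cstarGen s ≤ C :=
  NonUnitalStarSubalgebra.topologicalClosure_minimal _ (NonUnitalStarAlgebra.adjoin_le h) hC

/-- The linear span of a self-adjoint multiplicative set is already a `*`-algebra. This allows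
arguments with maps that are linear but not multiplicative, such as matrix coefficients. -/
lemma mem_closedSpan_of_mem_cstarGen {s : Set F} (hmul : ∀ x ∈ s, ∀ y ∈ s, x * y ∈ s)
    (hstar : ∀ x ∈ s, star x ∈ s) {x : F} (hx : x ∈ cstarGen s) :
    x ∈ (Submodule.span ℂ s).topologicalClosure := by
  have h : (NonUnitalStarAlgebra.adjoin ℂ s : Set F) ⊆ Submodule.span ℂ s := by
    intro y hy
    induction hy using NonUnitalStarAlgebra.adjoin_induction with
    | mem x hx => exact Submodule.subset_span hx
    | add x y _ _ hx hy => exact add_mem hx hy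
    | zero => exact zero_mem _
    | smul r x _ hx => exact Submodule.smul_mem _ r hx
    | mul x y _ _ hx hy =>
      refine Submodule.span_induction₂ (p := fun x y _ _ => x * y ∈ Submodule.span ℂ s)
        (fun x y hx hy => Submodule.subset_span (hmul x hx y hy)) (by simp) (by simp)
        (fun x y z _ _ _ hx hy => by rw [add_mul]; exact add_mem hx hy)
        (fun x y z _ _ _ hx hy => by rw [mul_add]; exact add_mem hx hy)
        (fun c x y _ _ h => by rw [smul_mul_assoc]; exact Submodule.smul_mem _ _ h)
        (fun c x y _ _ h => by rw [mul_smul_comm]; exact Submodule.smul_mem _ _ h) hx hy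
    | star x _ hx =>
      refine Submodule.span_induction (p := fun x _ => star x ∈ Submodule.span ℂ s)
        (fun x hx => Submodule.subset_span (hstar x hx)) (by simp)
        (fun x y _ _ hx hy => by rw [star_add]; exact add_mem hx hy)
        (fun c x _ hx => by rw [star_smul]; exact Submodule.smul_mem _ _ hx) hx
  exact closure_mono h hx

/-- A `*`-homomorphism of `C*`-algebras as a bounded linear map. -/
def homCLM {F' : Type*} [NonUnitalCStarAlgebra F'] (ψ : F →⋆ₙₐ[ℂ] F') : F →L[ℂ] F' :=
  LinearMap.mkContinuous
    { toFun := ψ, map_add' := map_add ψ, map_smul' := map_smul ψ } 1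
    fun x => by simpa using NonUnitalStarAlgHom.norm_apply_le ψ x

@[simp] lemma homCLM_apply {F' : Type*} [NonUnitalCStarAlgebra F'] (ψ : F →⋆ₙₐ[ℂ] F') (x : F) :
    homCLM ψ x = ψ x := rfl

lemma eqOn_cstarGen {F' : Type*} [NonUnitalCStarAlgebra F'] (ψ ψ' : F →⋆ₙₐ[ℂ] F') {s : Set F}
    (h : ∀ x ∈ s, ψ x = ψ' x) {x : F} (hx : x ∈ cstarGen s) : ψ x = ψ' x := by
  have key : cstarGen s ≤ NonUnitalStarAlgHom.equalizer ψ ψ' :=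
    cstarGen_le (isClosed_eq (homCLM ψ).continuous (homCLM ψ').continuous) h
  exact key hx

lemma map_mem_of_mem_cstarGen {F' : Type*} [NonUnitalCStarAlgebra F'] (ψ : F →⋆ₙₐ[ℂ] F')
    {s : Set F} {C : NonUnitalStarSubalgebra ℂ F'} (hC : IsClosed (C : Set F'))
    (h : ∀ x ∈ s, ψ x ∈ C) {x : F} (hx : x ∈ cstarGen s) : ψ x ∈ C := by
  have key : cstarGen s ≤ C.comap ψ :=
    cstarGen_le (hC.preimage (homCLM ψ).continuous) h
  exact key hx

/-- `T` multiplies the set `s` into `C` from both sides. -/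
def Multiplies (T : F) (s : Set F) (C : NonUnitalStarSubalgebra ℂ F) : Prop :=
  ∀ y ∈ s, T * y ∈ C ∧ y * T ∈ C

lemma Multiplies.cstarGen {s : Set F} {T : F} (h : Multiplies T s (cstarGen s))
    (h' : Multiplies (star T) s (cstarGen s)) :
    Multiplies T (CoactionDeformation.cstarGen s) (CoactionDeformation.cstarGen s) := by
  set C := CoactionDeformation.cstarGen s with hCdef
  have hC : IsClosed (C : Set F) := isClosed_cstarGen s
  -- The conditions on `star T` are included so that the carrier is stable under the involution.
  let N : NonUnitalStarSubalgebra ℂ F :=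
    { carrier := {y | y ∈ C ∧ (T * y ∈ C ∧ y * T ∈ C) ∧ (star T * y ∈ C ∧ y * star T ∈ C)}
      add_mem' := fun {x y} hx hy => by
        simp only [Set.mem_ofPred_eq, mul_add, add_mul] at *
        exact ⟨add_mem hx.1 hy.1, ⟨add_mem hx.2.1.1 hy.2.1.1, add_mem hx.2.1.2 hy.2.1.2⟩,
          ⟨add_mem hx.2.2.1 hy.2.2.1, add_mem hx.2.2.2 hy.2.2.2⟩⟩
      zero_mem' := by simp [zero_mem]
      mul_mem' := fun {x y} hx hy => by
        refine ⟨mul_mem hx.1 hy.1, ⟨?_, ?_⟩, ⟨?_, ?_⟩⟩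
        · rw [← mul_assoc]; exact mul_mem hx.2.1.1 hy.1
        · rw [mul_assoc]; exact mul_mem hx.1 hy.2.1.2
        · rw [← mul_assoc]; exact mul_mem hx.2.2.1 hy.1
        · rw [mul_assoc]; exact mul_mem hx.1 hy.2.2.2
      smul_mem' := fun c x hx => by
        simp only [Set.mem_ofPred_eq, mul_smul_comm, smul_mul_assoc] at *
        exact ⟨SMulMemClass.smul_mem c hx.1,
          ⟨SMulMemClass.smul_mem c hx.2.1.1, SMulMemClass.smul_mem c hx.2.1.2⟩,
          ⟨SMulMemClass.smul_mem c hx.2.2.1, SMulMemClass.smul_mem c hx.2.2.2⟩⟩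
      star_mem' := fun {x} hx => by
        refine ⟨star_mem hx.1, ⟨?_, ?_⟩, ⟨?_, ?_⟩⟩
        · simpa using star_mem hx.2.2.2
        · simpa using star_mem hx.2.2.1
        · simpa using star_mem hx.2.1.2
        · simpa using star_mem hx.2.1.1 }
  have hN : IsClosed (N : Set F) := by
    refine hC.inter (((hC.preimage (continuous_const_mul T)).inter
      (hC.preimage (continuous_mul_const T))).inter
      ((hC.preimage (continuous_const_mul (star T))).inter
      (hC.preimage (continuous_mul_const (star T)))))
  have key : C ≤ N := cstarGen_le hN fun y hy => ⟨subset_cstarGen s hy, h y hy, h' y hy⟩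
  exact fun y hy => (key hy).2.1

end Generated

/-! ### Approximation of continuous functions on the interval -/

/-- The Bernstein approximations of `F` are finite sums of scalar polynomials times values of `F`,
and they converge uniformly also for vector-valued functions. -/
lemma mem_closedSpan_smul_const {V : Type*} [NormedAddCommGroup V] [NormedSpace ℂ V]
    (F : C(I, V)) : F ∈ (Submodule.span ℂ
      {G : C(I, V) | ∃ (f : C(I, ℂ)) (v : V), G = f • ContinuousMap.const I v}).topologicalClosure := by
  refine mem_closure_of_tendsto (bernsteinApproximation_uniform F) (.of_forall fun n => ?_)
  refine sum_mem fun k _ => Submodule.subset_span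
    ⟨⟨fun x => (bernstein n k x : ℂ), by fun_prop⟩, F (bernstein.z k), ?_⟩
  ext x
  simp

/-! ### Coordinates -/

section Coordinates

variable {S T : Type*} {E : Type*} [NormedAddCommGroup E] [InnerProductSpace ℂ E]

@[simp] lemma diagU_apply (u : S → (E ≃ₗᵢ[ℂ] E)) (ξ : Ell2 S E) (s : S) :
    diagU u ξ s = u s (ξ s) := rfl

section
variable [CompleteSpace E]

@[simp] lemma amp_apply (x : Op E) (ξ : Ell2 S E) (s : S) : amp S E x ξ s = x (ξ s) := rfl

lemma conjHom_apply (V : E ≃ₗᵢ[ℂ] E) (x : Op E) (ξ : E) :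
    conjHom V x ξ = V (x (V.symm ξ)) := rfl

lemma conjHom_map (V : E ≃ₗᵢ[ℂ] E) (x : Op E) (ξ : E) : conjHom V x (V ξ) = V (x ξ) := by
  rw [conjHom_apply, V.symm_apply_apply]

lemma conjHom_eq_iff {V : E ≃ₗᵢ[ℂ] E} {x y : Op E} :
    conjHom V x = y ↔ ∀ ξ, V (x ξ) = y (V ξ) := by
  refine ⟨fun h ξ => ?_, fun h => ContinuousLinearMap.ext fun ξ => ?_⟩
  · rw [← h, conjHom_apply, V.symm_apply_apply]
  · rw [conjHom_apply, h, V.apply_symm_apply]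

end

open Classical in
lemma deltaProj_apply (s t : S) (ξ : Ell2 S E) :
    (deltaProj s : Op (Ell2 S E)) ξ t = if t = s then ξ t else 0 := by
  change lp.single (E := fun _ : S => E) 2 s (ξ s) t = _
  split_ifs with h
  · subst h; rw [lp.single_apply_self]
  · rw [lp.single_apply_ne _ _ _ h]

variable {Γ : Type*} [Group Γ]

@[simp] lemma rightU_apply (k : Γ) (ξ : Ell2 Γ E) (s : Γ) : rightU k ξ s = ξ (s * k) := by
  change ξ (s * k⁻¹⁻¹) = _
  rw [inv_inv]

lemma regularU_apply (ω : Γ → Γ → Circle) (ξ : Ell2 Γ (Ell2 Γ E)) (h t : Γ) :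
    regularU ω ξ h t = (ω h (h⁻¹ * t) : ℂ) • ξ h (h⁻¹ * t) := rfl

lemma regularU_symm_apply (ω : Γ → Γ → Circle) (ξ : Ell2 Γ (Ell2 Γ E)) (h t : Γ) :
    (regularU ω).symm ξ h t = (((ω h t)⁻¹ : Circle) : ℂ) • ξ h (h * t) := rfl

lemma coprodU_apply (ξ : Ell2 Γ (Ell2 Γ E)) (s h : Γ) :
    coprodU ξ s h = ξ (h⁻¹ * s) h := rfl

variable [CompleteSpace E]

@[simp] lemma lamTensor_apply (g : Γ) (x : Op E) (ξ : Ell2 Γ E) (s : Γ) :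
    lamTensor g x ξ s = x (ξ (g⁻¹ * s)) := rfl

lemma diagonalU_apply (ξ : Ell2 Γ (Ell2 Γ (Ell2 Γ E))) (s h t : Γ) :
    diagonalU Γ E ξ s h t = ξ (t⁻¹ * (h⁻¹ * s)) h t := rfl

open Classical in
/-- The matrix coefficient `⟨δ_g| T |δ_1⟩` of an operator `T` on `ℓ²(Γ) ⊗ E`. -/
def coeff (g : Γ) : Op (Ell2 Γ E) →L[ℂ] Op E :=
  (ContinuousLinearMap.compL ℂ E (Ell2 Γ E) E (lp.evalCLM ℂ (fun _ : Γ => E) 2 g)).comp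
    ((ContinuousLinearMap.compL ℂ E (Ell2 Γ E) (Ell2 Γ E)).flip
      (lp.singleContinuousLinearMap ℂ (fun _ : Γ => E) 2 1))

open Classical in
lemma coeff_apply (g : Γ) (T : Op (Ell2 Γ E)) (ξ : E) :
    coeff g T ξ = T (lp.single (E := fun _ : Γ => E) 2 1 ξ) g := rfl

open Classical in
lemma coeff_lamTensor (g h : Γ) (x : Op E) :
    coeff g (lamTensor h x) = if g = h then x else 0 := by
  ext ξ
  rw [coeff_apply, lamTensor_apply]
  split_ifs with hg
  · subst hg
    rw [inv_mul_cancel, lp.single_apply_self]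
  · rw [lp.single_apply_ne, map_zero]
    · simp
    · exact fun e => hg (inv_mul_eq_one.1 e).symm

lemma coeff_one_amp (x : Op E) : coeff (1 : Γ) (amp Γ E x) = x := by
  classical
  ext ξ
  rw [coeff_apply, amp_apply, lp.single_apply_self]

variable (X : Type*) in
/-- The matrix coefficient `⟨δ_g| T |δ_1⟩` of a field of operators. -/
def fldCoeff (g : Γ) : Fld X (Ell2 Γ E) →L[ℂ] Fld X E :=
  LinearMap.mkContinuous
    { toFun := fun T => mkFld (fun x => coeff g (T x)) (‖(coeff g : Op (Ell2 Γ E) →L[ℂ] Op E)‖ * ‖T‖)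
        fun x => ((coeff g).le_opNorm _).trans (mul_le_mul_of_nonneg_left
          (lp.norm_apply_le_norm (E := fun _ : X => Op (Ell2 Γ E)) ENNReal.top_ne_zero T x)
          (norm_nonneg _))
      map_add' := fun T T' => Fld.ext fun x => by exact map_add (coeff g) (T x) (T' x)
      map_smul' := fun c T => Fld.ext fun x => by exact map_smul (coeff g) c (T x) }
    ‖(coeff g : Op (Ell2 Γ E) →L[ℂ] Op E)‖ fun T => by
      refine lp.norm_le_of_forall_le (E := fun _ : X => Op E) (by positivity) fun x => ?_
      exact ((coeff g).le_opNorm _).trans (mul_le_mul_of_nonneg_left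
          (lp.norm_apply_le_norm (E := fun _ : X => Op (Ell2 Γ E)) ENNReal.top_ne_zero T x)
          (norm_nonneg _))

lemma fldCoeff_apply {X : Type*} (g : Γ) (T : Fld X (Ell2 Γ E)) (x : X) :
    fldCoeff X g T x = coeff g (T x) := rfl

end Coordinates

/-! ### Fields -/

section FieldLemmas

variable {X : Type*} {E : Type*} [NormedAddCommGroup E] [InnerProductSpace ℂ E] [CompleteSpace E]

@[simp] lemma Fld.mul_apply (T T' : Fld X E) (x : X) : (T * T') x = T x * T' x := rfl
@[simp] lemma Fld.star_apply (T : Fld X E) (x : X) : (star T) x = star (T x) := rfl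
@[simp] lemma constFld_apply (T : Op E) (x : X) : (constFld T : Fld X E) x = T := rfl
lemma scalarFld_apply [TopologicalSpace X] [CompactSpace X] (f : C(X, ℂ)) (x : X) :
    (scalarFld f : Fld X E) x = f x • (1 : Op E) := rfl
@[simp] lemma scalarFld_apply_apply [TopologicalSpace X] [CompactSpace X] (f : C(X, ℂ)) (x : X)
    (ξ : E) : (scalarFld f : Fld X E) x ξ = f x • ξ := rfl

lemma Fld.ext_vec {T T' : Fld X E} (h : ∀ x ξ, T x ξ = T' x ξ) : T = T' :=
  Fld.ext fun x => ContinuousLinearMap.ext (h x)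

section
variable [TopologicalSpace X] [CompactSpace X]

lemma scalarFld_comm (f : C(X, ℂ)) (T : Fld X E) : scalarFld f * T = T * scalarFld f :=
  Fld.ext_vec fun x ξ => (map_smul (T x) (f x) ξ).symm

lemma scalarFld_mul (f f' : C(X, ℂ)) :
    (scalarFld (f * f') : Fld X E) = scalarFld f * scalarFld f' :=
  Fld.ext_vec fun x ξ => mul_smul (f x) (f' x) ξ

lemma scalarFld_one_mul (T : Fld X E) : scalarFld 1 * T = T :=
  Fld.ext_vec fun x ξ => one_smul ℂ (T x ξ)

lemma star_scalarFld (f : C(X, ℂ)) : star (scalarFld f : Fld X E) = scalarFld (star f) :=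
  Fld.ext fun x => by
    rw [Fld.star_apply, scalarFld_apply, scalarFld_apply, star_smul, star_one]; rfl

end

lemma star_unitaryFld (u : X → (E ≃ₗᵢ[ℂ] E)) :
    star (unitaryFld u) = unitaryFld fun x => (u x).symm :=
  Fld.ext fun x => by
    rw [Fld.star_apply, ContinuousLinearMap.star_eq_adjoint]
    exact (u x).adjoint_eq_symm

/-- Conjugation of a field of operators by a field of unitaries. -/
def fldAd (V : X → (E ≃ₗᵢ[ℂ] E)) : Fld X E ≃⋆ₐ[ℂ] Fld X E :=
  { fldMap fun x => conjHom (V x) with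
    invFun := fldMap fun x => conjHom (V x)⁻¹
    left_inv := fun T => Fld.ext fun x => by
      change conjHom (V x)⁻¹ (conjHom (V x) (T x)) = T x
      rw [← conjHom_mul, inv_mul_cancel, conjHom_one]
    right_inv := fun T => Fld.ext fun x => by
      change conjHom (V x) (conjHom (V x)⁻¹ (T x)) = T x
      rw [← conjHom_mul, mul_inv_cancel, conjHom_one] }

lemma fldAd_symm_apply (V : X → (E ≃ₗᵢ[ℂ] E)) (T : Fld X E) (x : X) :
    (fldAd V).symm T x = conjHom (V x)⁻¹ (T x) := rfl

lemma fldAd_symm (V : X → (E ≃ₗᵢ[ℂ] E)) : (fldAd V).symm = fldAd fun x => (V x)⁻¹ := rfl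

lemma fldAd_eq_iff {V : X → (E ≃ₗᵢ[ℂ] E)} {T T' : Fld X E} :
    fldAd V T = T' ↔ ∀ x ξ, V x (T x ξ) = T' x (V x ξ) := by
  refine ⟨fun h x ξ => ?_, fun h => Fld.ext fun x => conjHom_eq_iff.2 (h x)⟩
  exact conjHom_eq_iff.1 (congrArg (fun T : Fld X E => T x) h) ξ

lemma fldAd_scalarFld [TopologicalSpace X] [CompactSpace X] (V : X → (E ≃ₗᵢ[ℂ] E)) (f : C(X, ℂ)) :
    fldAd V (scalarFld f) = scalarFld f :=
  fldAd_eq_iff.2 fun x ξ => map_smul (V x) (f x) ξ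

end FieldLemmas

/-! ### Spectral subspaces of a coaction -/

section Spectral

variable {Γ : Type*} [Group Γ]

section
variable {E : Type*} [NormedAddCommGroup E] [InnerProductSpace ℂ E] [CompleteSpace E]

lemma lamTensor_mul (g h : Γ) (x y : Op E) :
    lamTensor g x * lamTensor h y = lamTensor (g * h) (x * y) := by
  refine ContinuousLinearMap.ext fun ξ => lp.ext <| funext fun s => ?_
  change x (y (ξ (h⁻¹ * (g⁻¹ * s)))) = x (y (ξ ((g * h)⁻¹ * s)))
  rw [mul_inv_rev, mul_assoc]

lemma star_lamTensor (g : Γ) (x : Op E) : star (lamTensor g x) = lamTensor g⁻¹ (star x) := by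
  have h1 : star ((leftU g : Ell2 Γ E ≃ₗᵢ[ℂ] Ell2 Γ E).toContinuousLinearEquiv.toContinuousLinearMap) =
      (leftU g).symm.toContinuousLinearEquiv.toContinuousLinearMap :=
    LinearIsometryEquiv.adjoint_eq_symm _
  rw [lamTensor, star_mul, h1, ← map_star]
  refine ContinuousLinearMap.ext fun ξ => lp.ext <| funext fun s => ?_
  change star x (ξ (g * s)) = star x (ξ (g⁻¹⁻¹ * s))
  rw [inv_inv]

lemma coprodHom_lamTensor (g : Γ) (x : Op E) :
    coprodHom Γ E (lamTensor g x) = lamTensor g (lamTensor g x) := by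
  refine conjHom_eq_iff.2 fun ξ => lp.ext <| funext fun s => lp.ext <| funext fun h => ?_
  change x (ξ (h⁻¹ * s) (g⁻¹ * h)) = x (ξ ((g⁻¹ * h)⁻¹ * (g⁻¹ * s)) (g⁻¹ * h))
  congr 3
  group

end

variable {A : Type*} [NonUnitalCStarAlgebra A]
  {K : Type*} [NormedAddCommGroup K] [InnerProductSpace ℂ K] [CompleteSpace K]
  {π : A →⋆ₙₐ[ℂ] Op K}

/-- The spectral subspace of the elements of degree `g`. -/
def Coaction.spectral (α : Coaction Γ π) (g : Γ) : Set A :=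
  {a | α.toHom a = lamTensor g (π a)}

lemma mem_closedSpan_lamTensor {T : Op (Ell2 Γ K)} (hT : T ∈ spatialTensor Γ π) :
    T ∈ (Submodule.span ℂ {y | ∃ (g : Γ) (a : A), y = lamTensor g (π a)}).topologicalClosure := by
  refine mem_closedSpan_of_mem_cstarGen ?_ ?_ hT
  · rintro _ ⟨g, a, rfl⟩ _ ⟨h, b, rfl⟩
    exact ⟨g * h, a * b, by rw [lamTensor_mul, map_mul]⟩
  · rintro _ ⟨g, a, rfl⟩
    exact ⟨g⁻¹, star a, by rw [star_lamTensor, map_star]⟩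

/-- A faithful representation as a linear isometry. -/
def repIsometry (π : A →⋆ₙₐ[ℂ] Op K) (hπ : Function.Injective π) : A →ₗᵢ[ℂ] Op K where
  toFun := π
  map_add' := map_add π
  map_smul' := map_smul π
  norm_map' := NonUnitalStarAlgHom.norm_map π hπ

/-- The coefficient is a slice map on `C*_r(Γ) ⊗ A`: it has values in `π(A)` on the generators, and
`π(A)` is closed because a faithful representation is isometric. -/
lemma coeff_mem_range (hπ : Function.Injective π) (g : Γ) {T : Op (Ell2 Γ K)}
    (hT : T ∈ spatialTensor Γ π) : coeff g T ∈ (repIsometry π hπ).toLinearMap.range := by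
  classical
  have hc : IsClosed ((repIsometry π hπ).toLinearMap.range : Set (Op K)) := by
    rw [LinearMap.coe_range]
    exact (repIsometry π hπ).isometry.isClosedEmbedding.isClosed_range
  refine map_mem_of_mem_closedSpan (coeff g) hc ?_ (mem_closedSpan_lamTensor hT)
  · rintro _ ⟨h, a, rfl⟩
    rw [coeff_lamTensor]
    split_ifs
    · exact ⟨a, rfl⟩
    · exact zero_mem _

lemma coeff_coprodHom (g : Γ) {T : Op (Ell2 Γ K)} (hT : T ∈ spatialTensor Γ π) :
    coeff g (coprodHom Γ K T) = lamTensor g (coeff g T) := by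
  classical
  refine eqOn_closedSpan ((coeff g).comp (homCLM (coprodHom Γ K)))
    ((ContinuousLinearMap.mul ℂ (Op (Ell2 Γ K))
      (leftU g : Ell2 Γ K ≃ₗᵢ[ℂ] Ell2 Γ K).toContinuousLinearEquiv.toContinuousLinearMap).comp
      ((homCLM (amp Γ K)).comp (coeff g))) ?_ (mem_closedSpan_lamTensor hT)
  rintro _ ⟨h, a, rfl⟩
  change coeff g (coprodHom Γ K (lamTensor h (π a))) = lamTensor g (coeff g (lamTensor h (π a)))
  rw [coprodHom_lamTensor, coeff_lamTensor, coeff_lamTensor]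
  split_ifs with h
  · rw [h]
  · rw [lamTensor, map_zero, mul_zero]

/-- The slice at `g` is applied to the first leg of `(ι ⊗ α)α(a) = (δ ⊗ ι)α(a)`. The left side
becomes `α(b)`, and the right side `λ_g ⊗ π(b)`. -/
lemma mem_spectral_of_coeff (hπ : Function.Injective π) (α : Coaction Γ π) {g : Γ} {a b : A}
    (h : π b = coeff g (α.toHom a)) : b ∈ α.spectral g := by
  classical
  obtain ⟨F, hF, hF'⟩ := α.coassoc
  let ι := repIsometry π hπ
  let c : (spatialTensor Γ π).toSubmodule →L[ℂ] ι.toLinearMap.range :=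
    ((coeff g).comp (spatialTensor Γ π).toSubmodule.subtypeL).codRestrict _
      fun T => coeff_mem_range hπ g T.2
  let c' : (spatialTensor Γ π).toSubmodule →L[ℂ] A :=
    (ι.equivRange.symm.toContinuousLinearEquiv : _ →L[ℂ] A).comp c
  have hc' : ∀ T (b : A), π b = coeff g T.1 → c' T = b := fun T b hb => by
    change ι.equivRange.symm _ = b
    rw [LinearIsometryEquiv.symm_apply_eq]
    exact Subtype.ext hb.symm
  let L₁ : (spatialTensor Γ π).toSubmodule →L[ℂ] Op (Ell2 Γ K) := (coeff g).comp (homCLM F)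
  let L₂ : (spatialTensor Γ π).toSubmodule →L[ℂ] Op (Ell2 Γ K) := (homCLM α.toHom).comp c'
  have h₁ : ∀ T, L₁ T = coeff g (F T) := fun _ => rfl
  have h₂ : ∀ T, L₂ T = α.toHom (c' T) := fun _ => rfl
  have hs : {y | ∃ (g : Γ) (a : A), y = lamTensor g (π a)} ⊆
      ((spatialTensor Γ π).toSubmodule : Set (Op (Ell2 Γ K))) := subset_cstarGen _
  -- Slicing the first leg commutes with `ι ⊗ α`: on `λ_k ⊗ x` both maps give `α(x)` if `k = g` and
  -- zero otherwise.
  have key : L₁ ⟨α.toHom a, α.mem_tensor a⟩ = L₂ ⟨α.toHom a, α.mem_tensor a⟩ := by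
    refine eqOn_subtype_of_mem_closedSpan hs L₁ L₂ ?_ _
      (mem_closedSpan_lamTensor (α.mem_tensor a))
    rintro _ ⟨k, x, rfl⟩
    rw [h₁, h₂, hF, coeff_lamTensor]
    split_ifs with hg
    · rw [hc' _ x]
      rw [coeff_lamTensor, if_pos hg]
    · rw [hc' _ 0, map_zero]
      rw [coeff_lamTensor, if_neg hg, map_zero]
  rw [h₁, h₂, hF', hc' _ b h, coeff_coprodHom g (α.mem_tensor a), ← h] at key
  exact key.symm

/-- By the density condition `1 ⊗ a` is a limit of combinations of elements `(λ_g ⊗ 1)α(b)`, and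
slicing at the identity recovers `a`. -/
lemma mem_closedSpan_spectral (hπ : Function.Injective π) (α : Coaction Γ π) (a : A) :
    a ∈ (Submodule.span ℂ {a | ∃ g, a ∈ α.spectral g}).topologicalClosure := by
  classical
  let ι := repIsometry π hπ
  set S := Submodule.span ℂ {a | ∃ g, a ∈ α.spectral g}
  have h1 : lamTensor (1 : Γ) (π a) ∈ (Submodule.span ℂ
      {y : Op (Ell2 Γ K) | ∃ (g : Γ) (a : A),
        y = (leftU g : Ell2 Γ K ≃ₗᵢ[ℂ] Ell2 Γ K).toContinuousLinearEquiv.toContinuousLinearMap *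
          α.toHom a}).topologicalClosure := by
    have := lamTensor_mem (Γ := Γ) π 1 a
    rw [← SetLike.mem_coe, ← α.cancellation] at this
    exact this
  -- The coefficient of `(λ_g ⊗ 1)α(b)` at `1` is that of `α(b)` at `g⁻¹`, hence homogeneous of
  -- degree `g⁻¹`.
  have h2 := map_mem_of_mem_closedSpan (coeff 1) (p := (S.map ι.toLinearMap).topologicalClosure)
    (Submodule.isClosed_topologicalClosure _) (by
      rintro _ ⟨g, b, rfl⟩
      obtain ⟨c, hc⟩ := coeff_mem_range hπ g⁻¹ (α.mem_tensor b)
      refine Submodule.le_topologicalClosure _ ⟨c, Submodule.subset_span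
        ⟨g⁻¹, mem_spectral_of_coeff hπ α hc⟩, ?_⟩
      rw [hc]
      ext ξ
      rw [coeff_apply, coeff_apply]
      change _ = (α.toHom b) (lp.single 2 1 ξ) (g⁻¹ * 1)
      rw [mul_one]) h1
  rw [coeff_lamTensor, if_pos rfl] at h2
  change a ∈ closure (S : Set A)
  rw [ι.isometry.isEmbedding.isInducing.closure_eq_preimage_closure_image]
  exact h2

lemma mul_mem_spectral (α : Coaction Γ π) {g h : Γ} {a b : A} (ha : a ∈ α.spectral g)
    (hb : b ∈ α.spectral h) : a * b ∈ α.spectral (g * h) := by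
  change α.toHom (a * b) = _
  rw [map_mul, ha, hb, lamTensor_mul, map_mul]

lemma star_mem_spectral (α : Coaction Γ π) {g : Γ} {a : A} (ha : a ∈ α.spectral g) :
    star a ∈ α.spectral g⁻¹ := by
  change α.toHom (star a) = _
  rw [map_star, ha, star_lamTensor, map_star]

end Spectral

/-! ### Circle valued cocycles -/

section Cocycle

variable {Γ : Type*} [Group Γ]

/-- A normalized `U(1)`-valued `2`-cocycle. -/
structure IsCircleCocycle (τ : Γ → Γ → Circle) : Prop where
  cocycle : ∀ g h k, τ g h * τ (g * h) k = τ h k * τ g (h * k)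
  apply_one : ∀ g, τ g 1 = 1
  one_apply : ∀ g, τ 1 g = 1

lemma IsCircleCocycle.inv {τ : Γ → Γ → Circle} (h : IsCircleCocycle τ) :
    IsCircleCocycle fun g k => (τ g k)⁻¹ where
  cocycle g k l := by rw [← mul_inv, ← mul_inv, h.cocycle]
  apply_one g := by rw [h.apply_one, inv_one]
  one_apply g := by rw [h.one_apply, inv_one]

/-- A continuous family of normalized `U(1)`-valued cocycles. -/
structure IsCocycleFamily {X : Type*} [TopologicalSpace X] (τ : X → Γ → Γ → Circle) : Prop where
  cocycle : ∀ x, IsCircleCocycle (τ x)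
  continuous : ∀ g h, Continuous fun x => τ x g h

lemma IsCocycleFamily.inv {X : Type*} [TopologicalSpace X] {τ : X → Γ → Γ → Circle}
    (h : IsCocycleFamily τ) : IsCocycleFamily fun x g k => (τ x g k)⁻¹ where
  cocycle x := (h.cocycle x).inv
  continuous g k := (h.continuous g k).inv

/-- A continuous circle valued function as a complex valued one. -/
def phaseFun {X : Type*} [TopologicalSpace X] (u : X → Circle) (hu : Continuous u) : C(X, ℂ) :=
  ⟨fun x => u x, by fun_prop⟩

@[simp] lemma phaseFun_apply {X : Type*} [TopologicalSpace X] (u : X → Circle) (hu : Continuous u)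
    (x : X) : phaseFun u hu x = u x := rfl

end Cocycle

/-! ### The braided tensor product in the picture of the regular representation -/

section Homs

variable {X : Type*} {E : Type*} [NormedAddCommGroup E] [InnerProductSpace ℂ E] [CompleteSpace E]

variable (X E) in
/-- The embedding of the operators as constant fields. -/
def constHom : Op E →⋆ₙₐ[ℂ] Fld X E where
  toFun := constFld
  map_smul' _ _ := rfl
  map_zero' := rfl
  map_add' _ _ := rfl
  map_mul' _ _ := rfl
  map_star' _ := rfl

variable {Γ : Type*} [Group Γ] {A : Type*} [NonUnitalCStarAlgebra A]
  {K : Type*} [NormedAddCommGroup K] [InnerProductSpace ℂ K] [CompleteSpace K]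
  {π : A →⋆ₙₐ[ℂ] Op K}

/-- The homomorphism `a ↦ α(a)_{12}`. -/
def coaction12Hom (α : Coaction Γ π) : A →⋆ₙₐ[ℂ] Op (Ell2 Γ (Ell2 Γ K)) :=
  (conjHom (flipU (S := Γ) (T := Γ) (E := K))).comp ((amp Γ (Ell2 Γ K)).comp α.toHom)

lemma coaction12_apply_of_mem_spectral (α : Coaction Γ π) {g : Γ} {a : A} (ha : a ∈ α.spectral g)
    (ξ : Ell2 Γ (Ell2 Γ K)) (s t : Γ) : coaction12 α a ξ s t = π a (ξ (g⁻¹ * s) t) := by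
  rw [coaction12, show α.toHom a = _ from ha]
  rfl

end Homs

section Braided

variable {Γ : Type*} [Group Γ] {A : Type*} [NonUnitalCStarAlgebra A]
  {K : Type*} [NormedAddCommGroup K] [InnerProductSpace ℂ K] [CompleteSpace K]
  {π : A →⋆ₙₐ[ℂ] Op K} {X : Type*} [TopologicalSpace X] [CompactSpace X]

/-- The relations `λ_g λ_h = τ(g,h) λ_{gh}` and `λ_g* = τ(g⁻¹,g)⁻¹ λ_{g⁻¹}` introduce phases that
are continuous on `X`, so they are absorbed by the coefficient in `C(X)`. -/
lemma mem_closedSpan_twisted {τ : X → Γ → Γ → Circle} (hτ : IsCocycleFamily τ)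
    {y : Fld X (Ell2 Γ K)} (hy : y ∈ twistedGroupAlg K τ) :
    y ∈ (Submodule.span ℂ {y | ∃ (f : C(X, ℂ)) (g : Γ),
      y = scalarFld f * unitaryFld fun x => twistedLeftU (τ x) g}).topologicalClosure := by
  refine mem_closedSpan_of_mem_cstarGen ?_ ?_ (cstarGen_le (isClosed_cstarGen _) ?_ hy)
  · rintro _ ⟨f, g, rfl⟩ _ ⟨f', g', rfl⟩
    refine ⟨f * f' * phaseFun _ (hτ.continuous g g'), g * g', Fld.ext_vec fun x ξ => ?_⟩
    refine lp.ext <| funext fun s => ?_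
    change f x • (τ x g (g⁻¹ * s) : ℂ) • f' x • (τ x g' (g'⁻¹ * (g⁻¹ * s)) : ℂ) •
      ξ (g'⁻¹ * (g⁻¹ * s)) = (f x * f' x * τ x g g' : ℂ) • (τ x (g * g') ((g * g')⁻¹ * s) : ℂ) •
        ξ ((g * g')⁻¹ * s)
    have hc := congrArg (fun z : Circle => (z : ℂ)) ((hτ.cocycle x).cocycle g g' (g'⁻¹ * (g⁻¹ * s)))
    simp only [Circle.coe_mul, mul_inv_cancel_left] at hc
    rw [mul_inv_rev, mul_assoc g'⁻¹, smul_smul, smul_smul, smul_smul,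
      smul_smul]
    congr 1
    linear_combination (-f x * f' x) * hc
  · rintro _ ⟨f, g, rfl⟩
    refine ⟨star f * phaseFun _ (hτ.continuous g⁻¹ g).inv, g⁻¹, ?_⟩
    rw [star_mul, star_unitaryFld, star_scalarFld]
    refine Fld.ext_vec fun x ξ => lp.ext <| funext fun s => ?_
    change (((τ x g s)⁻¹ : Circle) : ℂ) • (star f) x • ξ (g * s) =
      ((star f) x * (((τ x g⁻¹ g)⁻¹ : Circle) : ℂ)) • (τ x g⁻¹ (g⁻¹⁻¹ * s) : ℂ) • ξ (g⁻¹⁻¹ * s)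
    have hc := (hτ.cocycle x).cocycle g⁻¹ g s
    rw [inv_mul_cancel, (hτ.cocycle x).one_apply, mul_one] at hc
    rw [inv_inv, smul_smul, smul_smul, mul_assoc, ← Circle.coe_mul, mul_comm]
    congr 4
    rw [hc, mul_inv, mul_assoc, inv_mul_cancel, mul_one]
  · rintro _ (⟨g, rfl⟩ | ⟨f, rfl⟩)
    · exact subset_cstarGen _ ⟨1, g, (scalarFld_one_mul _).symm⟩
    -- Normalization of the cocycle gives `λ_1 = 1`, so `C(X)` itself occurs among the monomials.
    · refine subset_cstarGen _ ⟨f, 1, Fld.ext_vec fun x ξ => lp.ext <| funext fun s => ?_⟩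
      change f x • ξ s = f x • (τ x 1 (1⁻¹ * s) : ℂ) • ξ (1⁻¹ * s)
      rw [(hτ.cocycle x).one_apply, inv_one, one_mul, Circle.coe_one, one_smul]

variable (π) in
/-- The field `f λ^{(τ̄)}_g ⊗ λ^{(τ)}_k ⊗ a` on `ℓ²(Γ)₁ ⊗ ℓ²(Γ)₃ ⊗ K₂`. -/
def twistedMonomial (τ : X → Γ → Γ → Circle) (g k : Γ) (a : A) (f : C(X, ℂ)) :
    Fld X (Ell2 Γ (Ell2 Γ K)) :=
  scalarFld f * (unitaryFld (fun x => twistedLeftU (fun g h => (τ x g h)⁻¹) g) *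
    (unitaryFld (fun x => diagU fun _ => twistedLeftU (τ x) k) *
      constFld (amp Γ (Ell2 Γ K) (amp Γ K (π a)))))

lemma twistedMonomial_apply (τ : X → Γ → Γ → Circle) (g k : Γ) (a : A) (f : C(X, ℂ)) (x : X)
    (ξ : Ell2 Γ (Ell2 Γ K)) (s t : Γ) : twistedMonomial π τ g k a f x ξ s t =
      (f x * (((τ x g (g⁻¹ * s))⁻¹ * τ x k (k⁻¹ * t) : Circle) : ℂ)) •
        π a (ξ (g⁻¹ * s) (k⁻¹ * t)) := by
  rw [Circle.coe_mul, mul_smul, mul_smul]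
  rfl

/-- The fields `f λ^{(τ̄)}_g ⊗ λ^{(τ)}_k ⊗ a` with `a` of degree `g`. -/
def twistedMonomials (α : Coaction Γ π) (τ : X → Γ → Γ → Circle) :
    Set (Fld X (Ell2 Γ (Ell2 Γ K))) :=
  {y | ∃ (g k : Γ) (a : A) (f : C(X, ℂ)), a ∈ α.spectral g ∧ y = twistedMonomial π τ g k a f}

lemma twistedMonomials_mul_mem (α : Coaction Γ π) {τ : X → Γ → Γ → Circle}
    (hτ : IsCocycleFamily τ) : ∀ y ∈ twistedMonomials α τ, ∀ z ∈ twistedMonomials α τ,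
      y * z ∈ twistedMonomials α τ := by
  rintro _ ⟨g, k, a, f, ha, rfl⟩ _ ⟨g', k', a', f', ha', rfl⟩
  refine ⟨g * g', k * k', a * a', f * f' * (phaseFun _ (hτ.inv.continuous g g') *
    phaseFun _ (hτ.continuous k k')), mul_mem_spectral α ha ha', Fld.ext_vec fun x ξ =>
      lp.ext <| funext fun s => lp.ext <| funext fun t => ?_⟩
  rw [Fld.mul_apply, mul_apply_eq_comp, twistedMonomial_apply, twistedMonomial_apply,
    twistedMonomial_apply, map_smul, map_mul, mul_apply_eq_comp, mul_inv_rev,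
    mul_inv_rev, mul_assoc g'⁻¹, mul_assoc k'⁻¹, smul_smul]
  have hc := congrArg (fun z : Circle => (z : ℂ))
    ((hτ.inv.cocycle x).cocycle g g' (g'⁻¹ * (g⁻¹ * s)))
  have hc' := congrArg (fun z : Circle => (z : ℂ))
    ((hτ.cocycle x).cocycle k k' (k'⁻¹ * (k⁻¹ * t)))
  simp only [mul_inv_cancel_left, Circle.coe_mul, ContinuousMap.mul_apply, phaseFun_apply] at *
  congr 1
  calc _ = f x * f' x * ((((τ x g' (g'⁻¹ * (g⁻¹ * s)))⁻¹ : Circle) : ℂ) *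
          (((τ x g (g⁻¹ * s))⁻¹ : Circle) : ℂ)) *
        ((τ x k' (k'⁻¹ * (k⁻¹ * t)) : ℂ) * (τ x k (k⁻¹ * t) : ℂ)) := by ring
    _ = _ := by rw [← hc, ← hc']; ring

lemma twistedMonomials_star_mem (α : Coaction Γ π) {τ : X → Γ → Γ → Circle}
    (hτ : IsCocycleFamily τ) : ∀ y ∈ twistedMonomials α τ, star y ∈ twistedMonomials α τ := by
  rintro _ ⟨g, k, a, f, ha, rfl⟩
  refine ⟨g⁻¹, k⁻¹, star a, star f * (phaseFun _ (hτ.inv.inv.continuous g⁻¹ g) *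
    phaseFun _ (hτ.inv.continuous k⁻¹ k)), star_mem_spectral α ha, ?_⟩
  rw [twistedMonomial, star_mul, star_mul, star_mul, star_unitaryFld, star_unitaryFld,
    star_scalarFld]
  refine Fld.ext_vec fun x ξ => lp.ext <| funext fun s => lp.ext <| funext fun t => ?_
  rw [twistedMonomial_apply, map_star]
  change (star (amp Γ (Ell2 Γ K) (amp Γ K (π a)))) _ s t = _
  rw [← map_star, ← map_star]
  change star (π a) ((((τ x k t)⁻¹ : Circle) : ℂ) • (((τ x g s)⁻¹⁻¹ : Circle) : ℂ) • (star f) x •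
    ξ (g * s) (k * t)) = _
  have hc := (hτ.cocycle x).cocycle g⁻¹ g s
  have hc' := (hτ.cocycle x).cocycle k⁻¹ k t
  rw [inv_mul_cancel, (hτ.cocycle x).one_apply, mul_one] at hc hc'
  rw [map_smul, map_smul, map_smul, smul_smul, smul_smul, inv_inv g, inv_inv k, inv_inv]
  simp only [ContinuousMap.mul_apply, phaseFun_apply]
  congr 1
  rw [← Circle.coe_mul, mul_assoc, ← Circle.coe_mul, ← Circle.coe_mul, mul_comm]
  congr 2
  rw [hc, hc', inv_inv]
  have key : ∀ p q r u : Circle, p⁻¹ * q = q * r * (p * u)⁻¹ * (r⁻¹ * u) := fun p q r u => by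
    apply Circle.ext
    have := Circle.coe_ne_zero p
    have := Circle.coe_ne_zero r
    have := Circle.coe_ne_zero u
    simp only [Circle.coe_mul, Circle.coe_inv]
    field_simp
  exact key _ _ _ _

/-- The second factor is by definition `W*(1 ⊗ y)W`, so conjugation by `W` returns `1 ⊗ y`. For `a`
of degree `g` the first factor is `λ_g ⊗ 1 ⊗ a`, and `λ_{gs} λ_s* = τ̄(g,s) λ_g` (twisted
translations) turns it into `λ^{(τ̄)}_g ⊗ λ^{(τ)}_g ⊗ a`. The remaining phase comes from `λ_g λ_h =
τ(g,h) λ_{gh}`. -/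
lemma fldAd_regularU_generator (α : Coaction Γ π) {τ : X → Γ → Γ → Circle}
    (hτ : IsCocycleFamily τ) {g : Γ} {a : A} (ha : a ∈ α.spectral g) (f : C(X, ℂ)) (h : Γ) :
    fldAd (fun x => regularU (τ x)) (constFld (coaction12 α a) *
      adjointCoaction Γ K τ (scalarFld f * unitaryFld fun x => twistedLeftU (τ x) h)) =
    twistedMonomial π τ g (g * h) a (f * phaseFun _ (hτ.continuous g h)) := by
  refine fldAd_eq_iff.2 fun x ξ => lp.ext <| funext fun s => lp.ext <| funext fun t => ?_
  rw [regularU_apply, Fld.mul_apply, mul_apply_eq_comp, constFld_apply,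
    coaction12_apply_of_mem_spectral α ha, twistedMonomial_apply]
  set η := regularU (τ x) ξ with hη
  change (τ x s (s⁻¹ * t) : ℂ) • π a ((((τ x (g⁻¹ * s) (s⁻¹ * t))⁻¹ : Circle) : ℂ) •
    f x • (τ x h (h⁻¹ * (g⁻¹ * s * (s⁻¹ * t))) : ℂ) •
      η (g⁻¹ * s) (h⁻¹ * (g⁻¹ * s * (s⁻¹ * t)))) = _
  have e1 : g⁻¹ * s * (s⁻¹ * t) = g⁻¹ * t := by group
  have hc := congrArg (fun z : Circle => (z : ℂ))
    ((hτ.cocycle x).cocycle g (g⁻¹ * s) (s⁻¹ * t))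
  have hc' := congrArg (fun z : Circle => (z : ℂ))
    ((hτ.cocycle x).cocycle g h (h⁻¹ * (g⁻¹ * t)))
  rw [e1, mul_inv_rev, mul_assoc h⁻¹, map_smul, map_smul, map_smul, smul_smul, smul_smul, smul_smul]
  rw [e1] at hc
  simp only [mul_inv_cancel_left, Circle.coe_mul, Circle.coe_inv, ContinuousMap.mul_apply,
    phaseFun_apply] at *
  congr 1
  have n1 : (τ x g (g⁻¹ * s) : ℂ) ≠ 0 := Circle.coe_ne_zero _
  have n2 : (τ x (g⁻¹ * s) (s⁻¹ * t) : ℂ) ≠ 0 := Circle.coe_ne_zero _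
  field_simp
  linear_combination (f x * τ x h (h⁻¹ * (g⁻¹ * t))) * hc -
    (f x * (τ x (g⁻¹ * s) (s⁻¹ * t))) * hc'

end Braided

/-! ### The deformed algebra -/

section DeformedAlgebra

variable {Γ : Type*} [Group Γ] {A : Type*} [NonUnitalCStarAlgebra A]
  {K : Type*} [NormedAddCommGroup K] [InnerProductSpace ℂ K] [CompleteSpace K]
  {π : A →⋆ₙₐ[ℂ] Op K} {X : Type*} [TopologicalSpace X] [CompactSpace X]

/-- By continuity in each factor separately it suffices to take `a` homogeneous and `y` a monomial
`f λ_h`. -/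
lemma fldAd_braidedTensor_mem (hπ : Function.Injective π) (α : Coaction Γ π)
    {τ : X → Γ → Γ → Circle} (hτ : IsCocycleFamily τ) {z : Fld X (Ell2 Γ (Ell2 Γ K))}
    (hz : z ∈ braidedTensor α τ) :
    fldAd (fun x => regularU (τ x)) z ∈
      (Submodule.span ℂ (twistedMonomials α τ)).topologicalClosure := by
  refine mem_closedSpan_of_mem_cstarGen (twistedMonomials_mul_mem α hτ)
    (twistedMonomials_star_mem α hτ) ?_
  set N := cstarGen (twistedMonomials α τ) with hN
  let Ψ : Fld X (Ell2 Γ (Ell2 Γ K)) →⋆ₙₐ[ℂ] Fld X (Ell2 Γ (Ell2 Γ K)) :=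
    fldMap fun x => conjHom (regularU (τ x))
  have hNc : IsClosed (N : Set (Fld X (Ell2 Γ (Ell2 Γ K)))) := isClosed_cstarGen _
  suffices h : ∀ y ∈ {z | ∃ (a : A) (y : twistedGroupAlg K τ),
      z = constFld (coaction12 α a) * adjointCoaction Γ K τ y}, Ψ y ∈ N from
    map_mem_of_mem_cstarGen Ψ hNc h hz
  rintro _ ⟨a, y, rfl⟩
  let Φ : Fld X (Ell2 Γ (Ell2 Γ K)) →L[ℂ] Fld X (Ell2 Γ (Ell2 Γ K)) :=
    homCLM Ψ
  let L₁ (y : Fld X (Ell2 Γ K)) : A →L[ℂ] Fld X (Ell2 Γ (Ell2 Γ K)) :=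
    Φ.comp (((ContinuousLinearMap.mul ℂ _).flip (adjointCoaction Γ K τ y)).comp
      (homCLM ((constHom X _).comp (coaction12Hom α))))
  let L₂ (a : A) : Fld X (Ell2 Γ K) →L[ℂ] Fld X (Ell2 Γ (Ell2 Γ K)) :=
    Φ.comp ((ContinuousLinearMap.mul ℂ _ (constFld (coaction12 α a))).comp
      (homCLM (adjointCoaction Γ K τ)))
  refine map_mem_of_mem_closedSpan (L₁ y) (p := N.toSubmodule) hNc ?_
    (mem_closedSpan_spectral hπ α a)
  rintro a ⟨g, ha⟩
  refine map_mem_of_mem_closedSpan (L₂ a) (p := N.toSubmodule) hNc ?_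
    (mem_closedSpan_twisted hτ y.2)
  rintro _ ⟨f, h, rfl⟩
  refine subset_cstarGen _ ⟨g, g * h, a, _, ha, fldAd_regularU_generator α hτ ha f h⟩

lemma fldAd_symm_twistedMonomial_apply (τ : X → Γ → Γ → Circle) (g k : Γ) (a : A) (f : C(X, ℂ))
    (x : X) (ξ : Ell2 Γ (Ell2 Γ K)) (s t : Γ) :
    (fldAd fun x => regularU (τ x)).symm (twistedMonomial π τ g k a f) x ξ s t =
      (((τ x s t)⁻¹ : Circle) : ℂ) •
      (f x * (((τ x g (g⁻¹ * s))⁻¹ * τ x k (k⁻¹ * (s * t)) : Circle) : ℂ)) •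
        π a ((τ x (g⁻¹ * s) ((g⁻¹ * s)⁻¹ * (k⁻¹ * (s * t))) : ℂ) •
          ξ (g⁻¹ * s) ((g⁻¹ * s)⁻¹ * (k⁻¹ * (s * t)))) := by
  rw [fldAd_symm_apply]
  change (((τ x s t)⁻¹ : Circle) : ℂ) •
    (twistedMonomial π τ g k a f x (regularU (τ x) ξ)) s (s * t) = _
  rw [twistedMonomial_apply, regularU_apply]

/-- The unitary defining the diagonal coaction translates the new leg by `st`, where `s, t` index
the two inner legs. This product is the second coordinate after `W`, and the monomial moves it by
`k`, whence the degree `k`. -/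
lemma diagonalCoaction_fldAd_symm (τ : X → Γ → Γ → Circle) (g k : Γ) (a : A) (f : C(X, ℂ))
    (x : X) :
    diagonalCoaction Γ K X ((fldAd fun x => regularU (τ x)).symm (twistedMonomial π τ g k a f)) x =
      lamTensor k ((fldAd fun x => regularU (τ x)).symm (twistedMonomial π τ g k a f) x) := by
  refine conjHom_eq_iff.2 fun ξ => ?_
  refine lp.ext <| funext fun r => lp.ext <| funext fun s => lp.ext <| funext fun t => ?_
  rw [diagonalU_apply, lamTensor_apply]
  change ((fldAd fun x => regularU (τ x)).symm (twistedMonomial π τ g k a f) x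
    (ξ (t⁻¹ * (s⁻¹ * r)))) s t = _
  rw [fldAd_symm_twistedMonomial_apply,
    fldAd_symm_twistedMonomial_apply, diagonalU_apply]
  congr 7
  group

lemma fldAd_deformation_mem (hπ : Function.Injective π) (α : Coaction Γ π)
    {ω : X → Γ → Γ → Circle} (hω : IsCocycleFamily ω) {z : Fld X (Ell2 Γ (Ell2 Γ K))}
    (hz : z ∈ deformation α ω) :
    fldAd (fun x => regularU fun g h => (ω x g h)⁻¹) z ∈
      (Submodule.span ℂ {y | ∃ (g : Γ) (a : A) (f : C(X, ℂ)), a ∈ α.spectral g ∧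
        y = twistedMonomial π (fun x g h => (ω x g h)⁻¹) g 1 a f}).topologicalClosure := by
  classical
  set τ : X → Γ → Γ → Circle := fun x g h => (ω x g h)⁻¹ with hτdef
  have hτ : IsCocycleFamily τ := hω.inv
  set Θ := fldAd fun x => regularU (E := K) (τ x) with hΘ
  obtain ⟨hz1, hz2⟩ := hz
  -- In the conjugated picture, `L` projects onto the degree-one part of the diagonal coaction: it
  -- fixes the image of a fixed point and kills the monomials with `k ≠ 1`.
  let L : Fld X (Ell2 Γ (Ell2 Γ K)) →L[ℂ] Fld X (Ell2 Γ (Ell2 Γ K)) :=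
    (homCLM (Θ : Fld X (Ell2 Γ (Ell2 Γ K)) →⋆ₙₐ[ℂ] Fld X (Ell2 Γ (Ell2 Γ K)))).comp
      ((fldCoeff X 1).comp ((homCLM (diagonalCoaction Γ K X)).comp
        (homCLM (Θ.symm : Fld X (Ell2 Γ (Ell2 Γ K)) →⋆ₙₐ[ℂ] Fld X (Ell2 Γ (Ell2 Γ K))))))
  have hL : ∀ y, L y = Θ (fldCoeff X 1 (diagonalCoaction Γ K X (Θ.symm y))) := fun _ => rfl
  have h1 : L (Θ z) = Θ z := by
    rw [hL, StarAlgEquiv.symm_apply_apply, show diagonalCoaction Γ K X z = _ from hz2]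
    congr 1
    exact Fld.ext fun x => coeff_one_amp (z x)
  rw [← h1]
  refine map_mem_of_mem_closedSpan L (Submodule.isClosed_topologicalClosure _) ?_
    (fldAd_braidedTensor_mem hπ α hτ hz1)
  rintro _ ⟨g, k, a, f, ha, rfl⟩
  have h2 : fldCoeff X 1 (diagonalCoaction Γ K X (Θ.symm (twistedMonomial π τ g k a f))) =
      if 1 = k then Θ.symm (twistedMonomial π τ g k a f) else 0 := by
    refine Fld.ext fun x => ?_
    rw [fldCoeff_apply, diagonalCoaction_fldAd_symm, coeff_lamTensor]
    split_ifs <;> rfl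
  rw [hL, h2]
  split_ifs with hk
  · subst hk
    rw [StarAlgEquiv.apply_symm_apply]
    exact Submodule.le_topologicalClosure _ (Submodule.subset_span ⟨g, a, f, ha, rfl⟩)
  · rw [map_zero]
    exact zero_mem _

lemma fldAd_symm_mem_deformation (α : Coaction Γ π)
    {ω : X → Γ → Γ → Circle} (hω : IsCocycleFamily ω) {g : Γ} {a : A} (ha : a ∈ α.spectral g)
    (f : C(X, ℂ)) :
    (fldAd (fun x => regularU fun g h => (ω x g h)⁻¹)).symm
      (twistedMonomial π (fun x g h => (ω x g h)⁻¹) g 1 a f) ∈ deformation α ω := by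
  set τ : X → Γ → Γ → Circle := fun x g h => (ω x g h)⁻¹ with hτdef
  have hτ : IsCocycleFamily τ := hω.inv
  refine ⟨?_, ?_⟩
  -- Total degree one forces `h = g⁻¹` in the braided generator; `f'` compensates its phase
  -- `ω̄(g,g⁻¹)`.
  · let f' : C(X, ℂ) := f * phaseFun _ (hω.continuous g g⁻¹)
    have hf : f' * phaseFun _ (hτ.continuous g g⁻¹) = f := by
      ext x
      change f x * (ω x g g⁻¹ : ℂ) * (((ω x g g⁻¹)⁻¹ : Circle) : ℂ) = f x
      rw [mul_assoc, ← Circle.coe_mul, mul_inv_cancel, Circle.coe_one, mul_one]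
    have h := fldAd_regularU_generator α hτ ha f' g⁻¹
    rw [mul_inv_cancel, hf, ← StarAlgEquiv.eq_symm_apply] at h
    rw [← h]
    refine subset_cstarGen _ ⟨a, ⟨_, mul_mem (subset_cstarGen _ ?_) (subset_cstarGen _ ?_)⟩, rfl⟩
    · exact .inr ⟨f', rfl⟩
    · exact .inl ⟨g⁻¹, rfl⟩
  · refine Fld.ext fun x => ?_
    rw [diagonalCoaction_fldAd_symm]
    refine ContinuousLinearMap.ext fun ξ => lp.ext <| funext fun s => ?_
    rw [lamTensor_apply, inv_one, one_mul]
    rfl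

end DeformedAlgebra

/-! ### The crossed product in the picture of the regular representation -/

section Crossed

variable {Γ : Type*} [Group Γ] {A : Type*} [NonUnitalCStarAlgebra A]
  {K : Type*} [NormedAddCommGroup K] [InnerProductSpace ℂ K] [CompleteSpace K]
  {π : A →⋆ₙₐ[ℂ] Op K} {X : Type*} [TopologicalSpace X] [CompactSpace X]

variable (π) in
/-- The operator `e_{g s, s} ⊗ 1 ⊗ 1 ⊗ a`. -/
def matrixOp (g s : Γ) (a : A) : Op (Ell2 Γ (Ell2 Γ (Ell2 Γ K))) :=
  lamTensor g (amp Γ (Ell2 Γ K) (amp Γ K (π a))) * deltaProj s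

open Classical in
lemma matrixOp_apply (g s : Γ) (a : A) (ξ : Ell2 Γ (Ell2 Γ (Ell2 Γ K))) (r h t : Γ) :
    matrixOp π g s a ξ r h t = if g⁻¹ * r = s then π a (ξ (g⁻¹ * r) h t) else 0 := by
  change π a ((deltaProj s : Op (Ell2 Γ (Ell2 Γ (Ell2 Γ K)))) ξ (g⁻¹ * r) h t) = _
  rw [deltaProj_apply]
  split_ifs
  · rfl
  · exact map_zero (π a)

variable (X) in
/-- The fields `f e_{g s, s} ⊗ 1 ⊗ 1 ⊗ a` with `a` of degree `g`. -/
def matrixFields (α : Coaction Γ π) : Set (Fld X (Ell2 Γ (Ell2 Γ (Ell2 Γ K)))) :=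
  {y | ∃ (g s : Γ) (a : A) (f : C(X, ℂ)), a ∈ α.spectral g ∧
    y = scalarFld f * constFld (matrixOp π g s a)}

variable (K) in
/-- The unitary `(W^{(ω)}_{01})* W^{(ω̄)}_{13}`, which untwists the crossed product. -/
def untwistU (ω : Γ → Γ → Circle) :
    Ell2 Γ (Ell2 Γ (Ell2 Γ K)) ≃ₗᵢ[ℂ] Ell2 Γ (Ell2 Γ (Ell2 Γ K)) :=
  (diagU fun _ => regularU fun g h => (ω g h)⁻¹).trans (regularU ω).symm

/-- In contrast to the diagonal coaction, the new leg is translated by the first coordinate `s`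
alone, which the monomial moves by `g`. -/
lemma deformedCoaction_fldAd_symm (τ : X → Γ → Γ → Circle) (g k : Γ) (a : A) (f : C(X, ℂ))
    (x : X) :
    deformedCoaction Γ K X ((fldAd fun x => regularU (τ x)).symm (twistedMonomial π τ g k a f)) x =
      lamTensor g ((fldAd fun x => regularU (τ x)).symm (twistedMonomial π τ g k a f) x) := by
  refine conjHom_eq_iff.2 fun ξ => ?_
  refine lp.ext <| funext fun r => lp.ext <| funext fun s => lp.ext <| funext fun t => ?_
  rw [coprodU_apply, lamTensor_apply]
  change ((fldAd fun x => regularU (τ x)).symm (twistedMonomial π τ g k a f) x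
    (ξ (s⁻¹ * r))) s t = _
  rw [fldAd_symm_twistedMonomial_apply, fldAd_symm_twistedMonomial_apply, coprodU_apply]
  congr 7
  group

lemma diagU_lamTensor_deltaProj {E : Type*} [NormedAddCommGroup E] [InnerProductSpace ℂ E]
    [CompleteSpace E] (V : E ≃ₗᵢ[ℂ] E) (g s : Γ) (y : Op E) (ξ : Ell2 Γ E) :
    diagU (fun _ => V) (lamTensor g y (deltaProj s ξ)) =
      lamTensor g (conjHom V y) (deltaProj s (diagU (fun _ => V) ξ)) := by
  classical
  refine lp.ext <| funext fun r => ?_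
  rw [diagU_apply, lamTensor_apply, lamTensor_apply, conjHom_eq_iff.1 rfl, deltaProj_apply,
    deltaProj_apply]
  split_ifs
  · rfl
  · rw [map_zero]

/-- The inverse regular unitary on legs `0, 1` replaces `λ^{(ω)}_g` at the matrix unit `e_{gs,s}` by
`(λ^{(ω)}_{gs})* λ^{(ω)}_g λ^{(ω)}_s`, which is the scalar `ω(g,s)`. -/
lemma regularU_symm_lamTensor_deltaProj {ω : X → Γ → Γ → Circle} (hω : IsCocycleFamily ω)
    (g s : Γ) (a : A) (f : C(X, ℂ)) (x : X) (η : Ell2 Γ (Ell2 Γ (Ell2 Γ K))) :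
    (regularU (ω x)).symm (lamTensor g (twistedMonomial π (fun x g h => (ω x g h)⁻¹) g 1 a f x)
      (deltaProj s η)) =
    (f x * (ω x g s : ℂ)) • matrixOp π g s a ((regularU (ω x)).symm η) := by
  classical
  refine lp.ext <| funext fun r => lp.ext <| funext fun h => lp.ext <| funext fun t => ?_
  change (((ω x r h)⁻¹ : Circle) : ℂ) • (twistedMonomial π (fun x g h => (ω x g h)⁻¹) g 1 a f x
      ((deltaProj s : Op (Ell2 Γ (Ell2 Γ (Ell2 Γ K)))) η (g⁻¹ * r))) (r * h) t =
    (f x * (ω x g s : ℂ)) • matrixOp π g s a ((regularU (ω x)).symm η) r h t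
  rw [matrixOp_apply, deltaProj_apply, twistedMonomial_apply]
  split_ifs with hr
  · obtain rfl : r = g * s := by rw [← hr, mul_inv_cancel_left]
    have e1 : g⁻¹ * (g * s * h) = s * h := by group
    have hc := (hω.cocycle x).cocycle g s h
    rw [regularU_symm_apply, e1, inv_mul_cancel_left, inv_one, one_mul, smul_smul]
    change _ = _ • π a ((((ω x s h)⁻¹ : Circle) : ℂ) • η s (s * h) t)
    rw [map_smul, smul_smul]
    congr 1
    rw [(hω.cocycle x).one_apply, inv_one, mul_one, inv_inv, mul_left_comm, mul_assoc (f x),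
      ← Circle.coe_mul, ← Circle.coe_mul]
    congr 2
    have key : ∀ p q u v : Circle, u * p = v * q → p⁻¹ * q = u * v⁻¹ := fun p q u v h => by
      rw [eq_mul_inv_iff_mul_eq, mul_assoc, inv_mul_eq_iff_eq_mul, mul_comm q, ← h, mul_comm]
    exact key _ _ _ _ hc
  · have : π a ((0 : Ell2 Γ (Ell2 Γ K)) (g⁻¹ * (r * h)) (1⁻¹ * t)) = 0 := map_zero (π a)
    rw [this, smul_zero, smul_zero, smul_zero]

/-- The key computation: up to a continuous phase, which `C(X)` absorbs, the untwisted generators do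
not involve `ω`. -/
lemma fldAd_untwistU_generator {ω : X → Γ → Γ → Circle} (hω : IsCocycleFamily ω) (g s : Γ) (a : A)
    (f : C(X, ℂ)) :
    fldAd (fun x => untwistU K (ω x)) (deformedCoaction Γ K X
      ((fldAd (fun x => regularU fun g h => (ω x g h)⁻¹)).symm
        (twistedMonomial π (fun x g h => (ω x g h)⁻¹) g 1 a f)) * constFld (deltaProj s)) =
    scalarFld (f * phaseFun _ (hω.continuous g s)) * constFld (matrixOp π g s a) := by
  refine fldAd_eq_iff.2 fun x ξ => ?_
  have e := congrArg (fun T : Fld X (Ell2 Γ (Ell2 Γ K)) => T x) (StarAlgEquiv.apply_symm_apply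
    (fldAd fun x => regularU fun g h => (ω x g h)⁻¹)
    (twistedMonomial π (fun x g h => (ω x g h)⁻¹) g 1 a f))
  have d := deformedCoaction_fldAd_symm (fun x g h => (ω x g h)⁻¹) g 1 a f (π := π) x
  generalize (fldAd fun x => regularU fun g h => (ω x g h)⁻¹).symm
    (twistedMonomial π (fun x g h => (ω x g h)⁻¹) g 1 a f) = m at e d ⊢
  change conjHom (regularU fun g h => (ω x g h)⁻¹) (m x) = _ at e
  calc _ = untwistU K (ω x) (deformedCoaction Γ K X m x (deltaProj s ξ)) := rfl
    _ = (regularU (ω x)).symm (diagU (fun _ => regularU fun g h => (ω x g h)⁻¹)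
          (lamTensor g (m x) (deltaProj s ξ))) := by rw [d]; rfl
    _ = (f x * (ω x g s : ℂ)) • matrixOp π g s a (untwistU K (ω x) ξ) := by
          rw [diagU_lamTensor_deltaProj, e, regularU_symm_lamTensor_deltaProj hω]; rfl

lemma fldAd_crossedProduct_mem (hπ : Function.Injective π) (α : Coaction Γ π)
    {ω : X → Γ → Γ → Circle} (hω : IsCocycleFamily ω)
    {z : Fld X (Ell2 Γ (Ell2 Γ (Ell2 Γ K)))} (hz : z ∈ cstarGen (crossedGenerators α ω)) :
    fldAd (fun x => untwistU K (ω x)) z ∈ cstarGen (matrixFields X α) := by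
  set N := cstarGen (matrixFields X α) with hN
  let Ψ : Fld X (Ell2 Γ (Ell2 Γ (Ell2 Γ K))) →⋆ₙₐ[ℂ] Fld X (Ell2 Γ (Ell2 Γ (Ell2 Γ K))) :=
    fldMap fun x => conjHom (untwistU K (ω x))
  have hNc : IsClosed (N : Set (Fld X (Ell2 Γ (Ell2 Γ (Ell2 Γ K))))) := isClosed_cstarGen _
  suffices h : ∀ y ∈ crossedGenerators α ω, Ψ y ∈ N from map_mem_of_mem_cstarGen Ψ hNc h hz
  rintro _ ⟨b, hb, s, rfl⟩
  let Θ : Fld X (Ell2 Γ (Ell2 Γ K)) →⋆ₙₐ[ℂ] Fld X (Ell2 Γ (Ell2 Γ K)) :=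
    fldMap fun x => conjHom (regularU fun g h => (ω x g h)⁻¹)⁻¹
  let L : Fld X (Ell2 Γ (Ell2 Γ K)) →L[ℂ] Fld X (Ell2 Γ (Ell2 Γ (Ell2 Γ K))) :=
    (homCLM Ψ).comp (((ContinuousLinearMap.mul ℂ _).flip (constFld (deltaProj s))).comp
      ((homCLM (deformedCoaction Γ K X)).comp (homCLM Θ)))
  have hL : ∀ y, L y = fldAd (fun x => untwistU K (ω x)) (deformedCoaction Γ K X
      ((fldAd (fun x => regularU fun g h => (ω x g h)⁻¹)).symm y) * constFld (deltaProj s)) :=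
    fun _ => rfl
  have key := map_mem_of_mem_closedSpan L (p := N.toSubmodule) hNc ?_
    (fldAd_deformation_mem hπ α hω hb)
  · rwa [hL, StarAlgEquiv.symm_apply_apply] at key
  · rintro _ ⟨g, a, f, ha, rfl⟩
    rw [hL, fldAd_untwistU_generator hω]
    exact subset_cstarGen _ ⟨g, s, a, _, ha, rfl⟩

lemma fldAd_symm_matrixFields_mem (α : Coaction Γ π)
    {ω : X → Γ → Γ → Circle} (hω : IsCocycleFamily ω)
    {n : Fld X (Ell2 Γ (Ell2 Γ (Ell2 Γ K)))} (hn : n ∈ cstarGen (matrixFields X α)) :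
    (fldAd (fun x => untwistU K (ω x))).symm n ∈ cstarGen (crossedGenerators α ω) := by
  set N := cstarGen (crossedGenerators α ω) with hN
  let Ψ : Fld X (Ell2 Γ (Ell2 Γ (Ell2 Γ K))) →⋆ₙₐ[ℂ] Fld X (Ell2 Γ (Ell2 Γ (Ell2 Γ K))) :=
    fldMap fun x => conjHom (untwistU K (ω x))⁻¹
  have hNc : IsClosed (N : Set (Fld X (Ell2 Γ (Ell2 Γ (Ell2 Γ K))))) := isClosed_cstarGen _
  suffices h : ∀ y ∈ matrixFields X α, Ψ y ∈ N from map_mem_of_mem_cstarGen Ψ hNc h hn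
  rintro _ ⟨g, s, a, f, ha, rfl⟩
  change (fldAd (fun x => untwistU K (ω x))).symm _ ∈ N
  let f' : C(X, ℂ) := f * phaseFun _ (hω.inv.continuous g s)
  have hf : f' * phaseFun _ (hω.continuous g s) = f := by
    ext x
    change f x * (((ω x g s)⁻¹ : Circle) : ℂ) * (ω x g s : ℂ) = f x
    rw [mul_assoc, ← Circle.coe_mul, inv_mul_cancel, Circle.coe_one, mul_one]
  have h := fldAd_untwistU_generator (π := π) hω g s a f'
  rw [hf, ← StarAlgEquiv.eq_symm_apply] at h
  rw [← h]
  exact subset_cstarGen _ ⟨_, fldAd_symm_mem_deformation α hω ha f', s, rfl⟩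

end Crossed

/-! ### Continuous functions into the crossed product as fields of operators -/

section ContinuousFields

variable {E : Type*} [NormedAddCommGroup E] [InnerProductSpace ℂ E] [CompleteSpace E]

variable (E) in
/-- Evaluation of a field over the one-point space. -/
def evalUnit : Fld Unit E →⋆ₙₐ[ℂ] Op E where
  toFun T := T ()
  map_smul' _ _ := rfl
  map_zero' := rfl
  map_add' _ _ := rfl
  map_mul' _ _ := rfl
  map_star' _ := rfl

lemma norm_evalUnit (T : Fld Unit E) : ‖evalUnit E T‖ = ‖T‖ :=
  NonUnitalStarAlgHom.norm_map (evalUnit E) (fun _ _ h => Fld.ext fun _ => h) T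

/-- A continuous function with values in an algebra of operators as a field of operators. -/
def continuousFld (X : Type*) [TopologicalSpace X] [CompactSpace X] (s : Set (Fld Unit E)) :
    C(X, CStarGen s) →⋆ₙₐ[ℂ] Fld X E where
  toFun F := mkFld (fun x => evalUnit E (CStarGen.incl s (F x))) ‖F‖ fun x => by
    rw [norm_evalUnit]
    exact F.norm_coe_le_norm x
  map_smul' _ _ := rfl
  map_zero' := rfl
  map_add' _ _ := rfl
  map_mul' _ _ := rfl
  map_star' _ := rfl

lemma continuousFld_smul {X : Type*} [TopologicalSpace X] [CompactSpace X]
    (s : Set (Fld Unit E)) (f : C(X, ℂ)) (F : C(X, CStarGen s)) :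
    continuousFld X s (f • F) = scalarFld f * continuousFld X s F := rfl

lemma continuousFld_injective (X : Type*) [TopologicalSpace X] [CompactSpace X]
    (s : Set (Fld Unit E)) : Function.Injective (continuousFld X s) := fun F F' h => by
  refine ContinuousMap.ext fun x => Subtype.ext (Fld.ext fun _ => ?_)
  exact congrArg (fun T : Fld X E => T x) h

end ContinuousFields

/-! ### Constant fields of crossed products in the untwisted picture -/

section Untwisted

variable {Γ : Type*} [Group Γ] {A : Type*} [NonUnitalCStarAlgebra A]
  {K : Type*} [NormedAddCommGroup K] [InnerProductSpace ℂ K] [CompleteSpace K]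
  {π : A →⋆ₙₐ[ℂ] Op K}

lemma scalarFld_mul_mem {X : Type*} [TopologicalSpace X] [CompactSpace X] (α : Coaction Γ π)
    (f : C(X, ℂ)) {n : Fld X (Ell2 Γ (Ell2 Γ (Ell2 Γ K)))} (hn : n ∈ cstarGen (matrixFields X α)) :
    scalarFld f * n ∈ cstarGen (matrixFields X α) := by
  have h : ∀ f : C(X, ℂ), Multiplies (scalarFld f) (matrixFields X α)
      (cstarGen (matrixFields X α)) := by
    rintro f _ ⟨g, s, a, f', ha, rfl⟩
    have : scalarFld f * (scalarFld f' * constFld (matrixOp π g s a)) ∈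
        cstarGen (matrixFields X α) := by
      rw [← mul_assoc, ← scalarFld_mul]
      exact subset_cstarGen _ ⟨g, s, a, _, ha, rfl⟩
    exact ⟨this, by rwa [← scalarFld_comm]⟩
  refine (Multiplies.cstarGen (h f) ?_ n hn).1
  rw [star_scalarFld]
  exact h _

lemma constFld_mem_matrixFields (α : Coaction Γ π)
    {n : Fld Unit (Ell2 Γ (Ell2 Γ (Ell2 Γ K)))} (hn : n ∈ cstarGen (matrixFields Unit α))
    (X : Type*) [TopologicalSpace X] [CompactSpace X] :
    (constFld (n ()) : Fld X _) ∈ cstarGen (matrixFields X α) := by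
  set N := cstarGen (matrixFields X α) with hN
  have hNc : IsClosed (N : Set (Fld X (Ell2 Γ (Ell2 Γ (Ell2 Γ K))))) := isClosed_cstarGen _
  let Ψ : Fld Unit (Ell2 Γ (Ell2 Γ (Ell2 Γ K))) →⋆ₙₐ[ℂ] Fld X (Ell2 Γ (Ell2 Γ (Ell2 Γ K))) :=
    (constHom X _).comp (evalUnit _)
  suffices h : ∀ y ∈ matrixFields Unit α, Ψ y ∈ N from map_mem_of_mem_cstarGen Ψ hNc h hn
  rintro _ ⟨g, s, a, f, ha, rfl⟩
  exact subset_cstarGen _ ⟨g, s, a, .const X (f ()), ha, rfl⟩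

/-- The homomorphism `F ↦ (V F(x) V*)_x`, where `V` untwists the crossed product. -/
def untwistHom (X : Type*) [TopologicalSpace X] [CompactSpace X] (α : Coaction Γ π)
    (ω : Γ → Γ → Circle) :
    C(X, CrossedProduct α fun _ : Unit => ω) →⋆ₙₐ[ℂ] Fld X (Ell2 Γ (Ell2 Γ (Ell2 Γ K))) :=
  (fldMap fun _ => conjHom (untwistU K ω)).comp (continuousFld X _)

lemma untwistHom_injective (X : Type*) [TopologicalSpace X] [CompactSpace X] (α : Coaction Γ π)
    (ω : Γ → Γ → Circle) : Function.Injective (untwistHom X α ω) :=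
  (EquivLike.injective (fldAd fun _ : X => untwistU K ω)).comp (continuousFld_injective X _)

lemma untwistHom_smul {X : Type*} [TopologicalSpace X] [CompactSpace X] (α : Coaction Γ π)
    (ω : Γ → Γ → Circle) (f : C(X, ℂ)) (F : C(X, CrossedProduct α fun _ : Unit => ω)) :
    untwistHom X α ω (f • F) = scalarFld f * untwistHom X α ω F := by
  change fldAd (fun _ => untwistU K ω) (continuousFld X _ (f • F)) = _
  rw [continuousFld_smul, map_mul, fldAd_scalarFld]
  rfl

lemma isCocycleFamily_const {X : Type*} [TopologicalSpace X] {ω : Γ → Γ → Circle}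
    (hω : IsCircleCocycle ω) : IsCocycleFamily fun _ : X => ω :=
  ⟨fun _ => hω, fun _ _ => continuous_const⟩

/-- Functions `f • v` with `v` constant span a dense subspace. A constant function untwists to a
constant field, and `C(I)` multiplies the target algebra into itself. -/
lemma untwistHom_mem (hπ : Function.Injective π) (α : Coaction Γ π) {ω : Γ → Γ → Circle}
    (hω : IsCircleCocycle ω) (F : C(I, CrossedProduct α fun _ : Unit => ω)) :
    untwistHom I α ω F ∈ cstarGen (matrixFields I α) := by
  set N := cstarGen (matrixFields I α) with hN
  have hNc : IsClosed (N : Set (Fld I (Ell2 Γ (Ell2 Γ (Ell2 Γ K))))) := isClosed_cstarGen _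
  refine map_mem_of_mem_closedSpan (homCLM (untwistHom I α ω)) (p := N.toSubmodule) hNc ?_
    (mem_closedSpan_smul_const F)
  rintro _ ⟨f, v, rfl⟩
  rw [homCLM_apply, untwistHom_smul]
  exact scalarFld_mul_mem α f (constFld_mem_matrixFields α
    (fldAd_crossedProduct_mem hπ α (isCocycleFamily_const hω) v.2) I)

/-- An injective `*`-homomorphism is isometric, so its range is closed and only the generators `f
e_{gs,s} ⊗ 1 ⊗ 1 ⊗ a` have to be reached. -/
lemma exists_untwistHom_eq (α : Coaction Γ π) {ω : Γ → Γ → Circle}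
    (hω : IsCircleCocycle ω) {n : Fld I (Ell2 Γ (Ell2 Γ (Ell2 Γ K)))}
    (hn : n ∈ cstarGen (matrixFields I α)) : ∃ F, untwistHom I α ω F = n := by
  set Ψ := untwistHom I α ω with hΨ
  have hc : IsClosed (NonUnitalStarAlgHom.range Ψ : Set (Fld I (Ell2 Γ (Ell2 Γ (Ell2 Γ K))))) := by
    have h := (AddMonoidHomClass.isometry_of_norm Ψ (NonUnitalStarAlgHom.norm_map Ψ
      (untwistHom_injective I α ω))).isClosedEmbedding.isClosed_range
    rwa [← NonUnitalStarAlgHom.coe_range] at h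
  refine cstarGen_le hc ?_ hn
  rintro _ ⟨g, s, a, f, ha, rfl⟩
  have h1 := fldAd_symm_matrixFields_mem α (isCocycleFamily_const (X := Unit) hω)
    (subset_cstarGen _ ⟨g, s, a, 1, ha, rfl⟩)
  refine ⟨f • .const I ⟨_, h1⟩, ?_⟩
  change untwistHom I α ω _ = _
  rw [untwistHom_smul]
  congr 1
  refine Fld.ext fun x => ?_
  have h2 := congrArg (fun T : Fld Unit _ => T ()) (StarAlgEquiv.apply_symm_apply
    (fldAd fun _ : Unit => untwistU K ω) (scalarFld 1 * constFld (matrixOp π g s a)))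
  exact h2.trans (congrArg (fun T : Fld Unit _ => T ()) (scalarFld_one_mul _))

end Untwisted

/-! ### The trivialization of the field of crossed products -/

section Trivialization

variable {Γ : Type*} [Group Γ] {A : Type*} [NonUnitalCStarAlgebra A]
  {K : Type*} [NormedAddCommGroup K] [InnerProductSpace ℂ K] [CompleteSpace K]
  {π : A →⋆ₙₐ[ℂ] Op K}

/-- The homomorphism `F ↦ (V_t* V F(t) V* V_t)_t` into the crossed product over the interval. -/
def trivializationHom (hπ : Function.Injective π) (α : Coaction Γ π) {ω : Γ → Γ → Circle}
    (hω : IsCircleCocycle ω) {ω' : I → Γ → Γ → Circle} (hω' : IsCocycleFamily ω') :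
    C(I, CrossedProduct α fun _ : Unit => ω) →⋆ₙₐ[ℂ] CrossedProduct α ω' where
  toFun F := ⟨(fldAd fun t => untwistU K (ω' t)).symm (untwistHom I α ω F),
    fldAd_symm_matrixFields_mem α hω' (untwistHom_mem hπ α hω F)⟩
  map_smul' c F := Subtype.ext <| by
    change (fldAd fun t => untwistU K (ω' t)).symm (untwistHom I α ω (c • F)) =
      c • (fldAd fun t => untwistU K (ω' t)).symm (untwistHom I α ω F)
    rw [map_smul, map_smul]
  map_zero' := Subtype.ext <| by
    change (fldAd fun t => untwistU K (ω' t)).symm (untwistHom I α ω 0) = 0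
    rw [map_zero, map_zero]
  map_add' F F' := Subtype.ext <| by
    change (fldAd fun t => untwistU K (ω' t)).symm (untwistHom I α ω (F + F')) =
      (fldAd fun t => untwistU K (ω' t)).symm (untwistHom I α ω F) +
      (fldAd fun t => untwistU K (ω' t)).symm (untwistHom I α ω F')
    rw [map_add, map_add]
  map_mul' F F' := Subtype.ext <| by
    change (fldAd fun t => untwistU K (ω' t)).symm (untwistHom I α ω (F * F')) =
      (fldAd fun t => untwistU K (ω' t)).symm (untwistHom I α ω F) *
      (fldAd fun t => untwistU K (ω' t)).symm (untwistHom I α ω F')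
    rw [map_mul, map_mul]
  map_star' F := Subtype.ext <| by
    change (fldAd fun t => untwistU K (ω' t)).symm (untwistHom I α ω (star F)) =
      star ((fldAd fun t => untwistU K (ω' t)).symm (untwistHom I α ω F))
    rw [map_star, map_star]

lemma trivializationHom_bijective (hπ : Function.Injective π) (α : Coaction Γ π)
    {ω : Γ → Γ → Circle} (hω : IsCircleCocycle ω) {ω' : I → Γ → Γ → Circle}
    (hω' : IsCocycleFamily ω') : Function.Bijective (trivializationHom hπ α hω hω') := by
  refine ⟨fun F F' h => ?_, fun z => ?_⟩
  · exact untwistHom_injective I α ω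
      (EquivLike.injective (fldAd fun t => untwistU K (ω' t)).symm (congrArg Subtype.val h))
  · obtain ⟨F, hF⟩ := exists_untwistHom_eq α hω (fldAd_crossedProduct_mem hπ α hω' z.2)
    refine ⟨F, Subtype.ext ?_⟩
    change (fldAd fun t => untwistU K (ω' t)).symm (untwistHom I α ω F) = z.1
    rw [hF, StarAlgEquiv.symm_apply_apply]

/-- The isomorphism of the constant field of crossed products with the twisted one. -/
def trivialization (hπ : Function.Injective π) (α : Coaction Γ π) {ω : Γ → Γ → Circle}
    (hω : IsCircleCocycle ω) {ω' : I → Γ → Γ → Circle} (hω' : IsCocycleFamily ω') :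
    C(I, CrossedProduct α fun _ : Unit => ω) ≃⋆ₐ[ℂ] CrossedProduct α ω' :=
  StarAlgEquiv.ofBijective (trivializationHom hπ α hω hω') (trivializationHom_bijective hπ α hω hω')

lemma incl_trivialization (hπ : Function.Injective π) (α : Coaction Γ π) {ω : Γ → Γ → Circle}
    (hω : IsCircleCocycle ω) {ω' : I → Γ → Γ → Circle} (hω' : IsCocycleFamily ω')
    (F : C(I, CrossedProduct α fun _ : Unit => ω)) :
    CStarGen.incl _ (trivialization hπ α hω hω' F) =
      (fldAd fun t => untwistU K (ω' t)).symm (untwistHom I α ω F) := rfl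

lemma incl_trivialization_smul (hπ : Function.Injective π) (α : Coaction Γ π) {ω : Γ → Γ → Circle}
    (hω : IsCircleCocycle ω) {ω' : I → Γ → Γ → Circle} (hω' : IsCocycleFamily ω')
    (f : C(I, ℂ)) (F : C(I, CrossedProduct α fun _ : Unit => ω)) :
    CStarGen.incl _ (trivialization hπ α hω hω' (f • F)) =
      scalarFld f * CStarGen.incl _ (trivialization hπ α hω hω' F) := by
  rw [incl_trivialization, incl_trivialization, untwistHom_smul, map_mul, fldAd_symm,
    fldAd_scalarFld]

end Trivialization

/-! ### The dual action in the picture of the regular representation -/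

section Dual

variable {Γ : Type*} [Group Γ] {A : Type*} [NonUnitalCStarAlgebra A]
  {K : Type*} [NormedAddCommGroup K] [InnerProductSpace ℂ K] [CompleteSpace K]
  {π : A →⋆ₙₐ[ℂ] Op K}

variable (K) in
/-- The unitary `∑_s ω̄(s, k) δ_s ρ_k ⊗ λ^{(ω)}_k`. -/
def twistedRightU (ω : Γ → Γ → Circle) (k : Γ) :
    Ell2 Γ (Ell2 Γ (Ell2 Γ K)) ≃ₗᵢ[ℂ] Ell2 Γ (Ell2 Γ (Ell2 Γ K)) :=
  (rightU k).trans (diagU fun s => (twistedLeftU ω k).trans (phaseU (ω s k)⁻¹))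

/-- The part of `untwistU` on legs `1, 3` commutes with `ρ_k` on leg `0`. The part on legs `0, 1`
contributes `(λ^{(ω)}_r)* λ^{(ω)}_{rk} = ω̄(r,k) λ^{(ω)}_k`. -/
lemma untwistU_rightU {ω : Γ → Γ → Circle} (hω : IsCircleCocycle ω) (k : Γ)
    (ξ : Ell2 Γ (Ell2 Γ (Ell2 Γ K))) :
    untwistU K ω (rightU k ξ) = twistedRightU K ω k (untwistU K ω ξ) := by
  set η : Ell2 Γ (Ell2 Γ (Ell2 Γ K)) := diagU (fun _ => regularU fun g h => (ω g h)⁻¹) ξ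
  have h1 : untwistU K ω (rightU k ξ) = (regularU ω).symm (rightU k η) := rfl
  have h2 : untwistU K ω ξ = (regularU ω).symm η := rfl
  rw [h1, h2]
  refine lp.ext <| funext fun r => lp.ext <| funext fun h => ?_
  rw [regularU_symm_apply, rightU_apply]
  change _ = (((ω r k)⁻¹ : Circle) : ℂ) • (ω k (k⁻¹ * h) : ℂ) •
    (rightU k ((regularU ω).symm η)) r (k⁻¹ * h)
  rw [rightU_apply, regularU_symm_apply, smul_smul, smul_smul]
  have e1 : r * k * (k⁻¹ * h) = r * h := by group
  have hc := hω.cocycle r k (k⁻¹ * h)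
  rw [mul_inv_cancel_left] at hc
  rw [e1, ← Circle.coe_mul, ← Circle.coe_mul]
  congr 2
  have key : ∀ p q u v : Circle, u * p = q * v → v⁻¹ = u⁻¹ * q * p⁻¹ := fun p q u v h => by
    rw [eq_mul_inv_iff_mul_eq, eq_inv_mul_iff_mul_eq, mul_left_comm, h, mul_comm, mul_inv_cancel_right]
  exact key _ _ _ _ hc

/-- The matrix unit is trivial on leg `1`, so `λ^{(ω)}_k` there passes through it; only the row and
column phases of the diagonal part survive. -/
lemma twistedRightU_matrixOp (ω : Γ → Γ → Circle) (k g s : Γ) (a : A)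
    (ξ : Ell2 Γ (Ell2 Γ (Ell2 Γ K))) :
    twistedRightU K ω k (matrixOp π g s a ξ) =
      (((ω (g * (s * k⁻¹)) k)⁻¹ * ω (s * k⁻¹) k : Circle) : ℂ) •
        matrixOp π g (s * k⁻¹) a (twistedRightU K ω k ξ) := by
  classical
  refine lp.ext <| funext fun r => lp.ext <| funext fun h => lp.ext <| funext fun t => ?_
  change (((ω r k)⁻¹ : Circle) : ℂ) • (ω k (k⁻¹ * h) : ℂ) •
    rightU k (matrixOp π g s a ξ) r (k⁻¹ * h) t =
      (((ω (g * (s * k⁻¹)) k)⁻¹ * ω (s * k⁻¹) k : Circle) : ℂ) •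
        matrixOp π g (s * k⁻¹) a (twistedRightU K ω k ξ) r h t
  rw [rightU_apply, matrixOp_apply, matrixOp_apply]
  have e : g⁻¹ * (r * k) = s ↔ g⁻¹ * r = s * k⁻¹ := by rw [← mul_assoc, eq_mul_inv_iff_mul_eq]
  simp only [e]
  split_ifs with hr
  · change _ = _ • π a ((((ω (g⁻¹ * r) k)⁻¹ : Circle) : ℂ) • (ω k (k⁻¹ * h) : ℂ) •
      (rightU k ξ) (g⁻¹ * r) (k⁻¹ * h) t)
    obtain rfl : r = g * (s * k⁻¹) := by rw [← hr, mul_inv_cancel_left]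
    have e2 : g⁻¹ * (g * (s * k⁻¹) * k) = g⁻¹ * (g * (s * k⁻¹)) * k := by group
    rw [rightU_apply, e2, hr, map_smul, map_smul, smul_smul, smul_smul, smul_smul,
      ← Circle.coe_mul, ← Circle.coe_mul, ← Circle.coe_mul]
    congr 2
    have key : ∀ p q u : Circle, p⁻¹ * q = p⁻¹ * u * u⁻¹ * q := fun p q u => by
      rw [mul_inv_cancel_right]
    exact key _ _ _
  · rw [smul_zero, smul_zero, smul_zero]

lemma diagU_matrixOp (d : Γ → Circle) (g s : Γ) (a : A) (ξ : Ell2 Γ (Ell2 Γ (Ell2 Γ K))) :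
    diagU (fun s => phaseU (d s)) (matrixOp π g s a ξ) = (d (g * s) : ℂ) • matrixOp π g s a ξ := by
  classical
  refine lp.ext <| funext fun r => lp.ext <| funext fun h => lp.ext <| funext fun t => ?_
  change (d r : ℂ) • matrixOp π g s a ξ r h t = (d (g * s) : ℂ) • matrixOp π g s a ξ r h t
  rw [matrixOp_apply]
  split_ifs with hr
  · rw [← hr, mul_inv_cancel_left]
  · rw [smul_zero, smul_zero]

lemma matrixOp_diagU (d : Γ → Circle) (g s : Γ) (a : A) (ξ : Ell2 Γ (Ell2 Γ (Ell2 Γ K))) :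
    matrixOp π g s a (diagU (fun s => phaseU (d s)) ξ) = (d s : ℂ) • matrixOp π g s a ξ := by
  classical
  refine lp.ext <| funext fun r => lp.ext <| funext fun h => lp.ext <| funext fun t => ?_
  change _ = (d s : ℂ) • matrixOp π g s a ξ r h t
  rw [matrixOp_apply, matrixOp_apply]
  split_ifs with hr
  · change π a ((d (g⁻¹ * r) : ℂ) • ξ (g⁻¹ * r) h t) = _
    rw [hr, map_smul]
  · rw [smul_zero]

lemma untwistU_diagU (ω : Γ → Γ → Circle) (d : Γ → Circle) (ξ : Ell2 Γ (Ell2 Γ (Ell2 Γ K))) :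
    untwistU K ω (diagU (fun s => phaseU (d s)) ξ) =
      diagU (fun s => phaseU (d s)) (untwistU K ω ξ) := by
  refine lp.ext <| funext fun r => ?_
  change (twistedLeftU ω r).symm (regularU (fun g h => (ω g h)⁻¹) ((d r : ℂ) • ξ r)) =
    (d r : ℂ) • (twistedLeftU ω r).symm (regularU (fun g h => (ω g h)⁻¹) (ξ r))
  rw [map_smul, map_smul]

variable (K) in
/-- The field of diagonal unitaries `∑_s d_t(s) δ_s ⊗ 1`. -/
def diagFld {X : Type*} (d : X → Γ → Circle) : Fld X (Ell2 Γ (Ell2 Γ (Ell2 Γ K))) :=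
  unitaryFld fun x => diagU fun s => phaseU (d x s)

lemma star_diagFld {X : Type*} (d : X → Γ → Circle) :
    star (diagFld K d) = diagFld K fun x s => (d x s)⁻¹ :=
  star_unitaryFld _

lemma diagFld_mul {X : Type*} (d d' : X → Γ → Circle) :
    diagFld K d * diagFld K d' = diagFld K fun x s => d x s * d' x s := by
  refine Fld.ext_vec fun x ξ => lp.ext <| funext fun s => ?_
  change (d x s : ℂ) • (d' x s : ℂ) • ξ s = ((d x s * d' x s : Circle) : ℂ) • ξ s
  rw [Circle.coe_mul, mul_smul]

lemma diagFld_one_mul {X : Type*} (T : Fld X (Ell2 Γ (Ell2 Γ (Ell2 Γ K)))) :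
    diagFld K (fun _ _ => 1) * T = T := by
  refine Fld.ext_vec fun x ξ => lp.ext <| funext fun s => ?_
  change ((1 : Circle) : ℂ) • T x ξ s = T x ξ s
  rw [Circle.coe_one, one_smul]

/-- Since `untwistU` is diagonal in leg `0`, it commutes with scalar phases there; the same diagonal
unitaries thus serve as multipliers in both pictures. -/
lemma fldAd_untwistU_diagFld {X : Type*} (ω : X → Γ → Γ → Circle) (d : X → Γ → Circle) :
    fldAd (fun x => untwistU K (ω x)) (diagFld K d) = diagFld K d :=
  fldAd_eq_iff.2 fun x ξ => untwistU_diagU (ω x) (d x) ξ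

lemma diagFld_multiplies {X : Type*} [TopologicalSpace X] [CompactSpace X] (α : Coaction Γ π)
    (d : X → Γ → Circle) (hd : ∀ s, Continuous fun x => d x s) :
    Multiplies (diagFld K d) (cstarGen (matrixFields X α)) (cstarGen (matrixFields X α)) := by
  have h : ∀ d : X → Γ → Circle, (∀ s, Continuous fun x => d x s) →
      Multiplies (diagFld K d) (matrixFields X α) (cstarGen (matrixFields X α)) := by
    rintro d hd _ ⟨g, s, a, f, ha, rfl⟩
    constructor
    · refine subset_cstarGen _ ⟨g, s, a, phaseFun _ (hd (g * s)) * f, ha, ?_⟩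
      refine Fld.ext_vec fun x ξ => ?_
      change diagU (fun s => phaseU (d x s)) (f x • matrixOp π g s a ξ) =
        ((d x (g * s) : ℂ) * f x) • matrixOp π g s a ξ
      rw [map_smul, diagU_matrixOp, smul_smul, mul_comm]
    · refine subset_cstarGen _ ⟨g, s, a, phaseFun _ (hd s) * f, ha, ?_⟩
      refine Fld.ext_vec fun x ξ => ?_
      change f x • matrixOp π g s a (diagU (fun s => phaseU (d x s)) ξ) =
        ((d x s : ℂ) * f x) • matrixOp π g s a ξ
      rw [matrixOp_diagU, smul_smul, mul_comm]
  refine Multiplies.cstarGen (h d hd) ?_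
  rw [star_diagFld]
  exact h _ fun s => (hd s).inv

end Dual

/-! ### Multipliers of generated `C*`-algebras -/

section Multipliers

variable {F : Type*} [NonUnitalCStarAlgebra F]

/-- The multiplier of `CStarGen s` given by an element of an ambient `C*`-algebra. -/
def ambientMultiplier (s : Set F) (T : F) (hT : Multiplies T (cstarGen s) (cstarGen s)) :
    𝓜(ℂ, CStarGen s) where
  fst := LinearMap.mkContinuous
    { toFun := fun y => (⟨T * y.1, (hT y.1 y.2).1⟩ : CStarGen s)
      map_add' := fun y z => Subtype.ext (mul_add T y.1 z.1)
      map_smul' := fun c y => Subtype.ext (mul_smul_comm c T y.1) } ‖T‖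
    fun y => norm_mul_le T y.1
  snd := LinearMap.mkContinuous
    { toFun := fun y => (⟨y.1 * T, (hT y.1 y.2).2⟩ : CStarGen s)
      map_add' := fun y z => Subtype.ext (add_mul y.1 z.1 T)
      map_smul' := fun c y => Subtype.ext (smul_mul_assoc c y.1 T) } ‖T‖
    fun y => (norm_mul_le y.1 T).trans_eq (mul_comm _ _)
  central y z := Subtype.ext (mul_assoc y.1 T z.1)

variable {s : Set F}

lemma DoubleCentralizer.ext_incl {m m' : 𝓜(ℂ, CStarGen s)}
    (h₁ : ∀ y, (m.fst y).1 = (m'.fst y).1) (h₂ : ∀ y, (m.snd y).1 = (m'.snd y).1) : m = m' :=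
  DoubleCentralizer.ext ℂ _ _ _ (Prod.ext (ContinuousLinearMap.ext fun y => Subtype.ext (h₁ y))
    (ContinuousLinearMap.ext fun y => Subtype.ext (h₂ y)))

lemma star_ambientMultiplier {T : F} (hT : Multiplies T (cstarGen s) (cstarGen s))
    (hT' : Multiplies (star T) (cstarGen s) (cstarGen s)) :
    star (ambientMultiplier s T hT) = ambientMultiplier s (star T) hT' := by
  refine DoubleCentralizer.ext_incl (fun y => ?_) fun y => ?_
  · rw [DoubleCentralizer.star_fst]
    change star (star y.1 * T) = star T * y.1
    rw [star_mul, star_star]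
  · rw [DoubleCentralizer.star_snd]
    change star (T * star y.1) = y.1 * star T
    rw [star_mul, star_star]

lemma ambientMultiplier_mul {T T' T'' : F} (hT : Multiplies T (cstarGen s) (cstarGen s))
    (hT' : Multiplies T' (cstarGen s) (cstarGen s))
    (hT'' : Multiplies T'' (cstarGen s) (cstarGen s)) (h : T * T' = T'') :
    ambientMultiplier s T hT * ambientMultiplier s T' hT' = ambientMultiplier s T'' hT'' := by
  subst h
  refine DoubleCentralizer.ext_incl (fun y => ?_) fun y => ?_
  · exact (mul_assoc T T' y.1).symm
  · exact mul_assoc y.1 T T'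

lemma multiplierMap_ambientMultiplier {G : Type*} [Group G] (Θ : G →* (F ≃⋆ₐ[ℂ] F))
    (h : ∀ g, ∀ x ∈ s, Θ g x ∈ s) (g : G) {T : F} (hT : Multiplies T (cstarGen s) (cstarGen s))
    (hT' : Multiplies (Θ g T) (cstarGen s) (cstarGen s)) :
    multiplierMap (restrictAction Θ s h g) (ambientMultiplier s T hT) =
      ambientMultiplier s (Θ g T) hT' := by
  have e : ∀ y : F, Θ g (Θ g⁻¹ y) = y := fun y => by
    rw [← StarAlgEquiv.mul_apply, ← map_mul, mul_inv_cancel, map_one, StarAlgEquiv.one_apply]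
  refine DoubleCentralizer.ext_incl (fun y => ?_) fun y => ?_
  · change Θ g (T * Θ g⁻¹ y.1) = Θ g T * y.1
    rw [map_mul, e]
  · change Θ g (Θ g⁻¹ y.1 * T) = y.1 * Θ g T
    rw [map_mul, e]

/-- Reduces exterior equivalence to identities in an ambient algebra. Unitarity is expressed by its
effect on elements because the ambient algebra is not assumed unital. -/
lemma exteriorEquivalent_of_ambient {G : Type*} [Group G] (Θ : G →* (F ≃⋆ₐ[ℂ] F))
    (h : ∀ g, ∀ x ∈ s, Θ g x ∈ s) (γ : G →* (CStarGen s ≃⋆ₐ[ℂ] CStarGen s)) (U : G → F)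
    (hU : ∀ g, Multiplies (U g) (cstarGen s) (cstarGen s))
    (hU' : ∀ g, Multiplies (star (U g)) (cstarGen s) (cstarGen s))
    (h₁ : ∀ g y, star (U g) * (U g * y) = y) (h₂ : ∀ g y, U g * (star (U g) * y) = y)
    (hmul : ∀ g k, U g * Θ g (U k) = U (g * k))
    (hconj : ∀ g (z : CStarGen s), (γ g z).1 = U g * Θ g z.1 * star (U g)) :
    ExteriorEquivalent (restrictAction Θ s h) γ := by
  have h₁' : ∀ g y, y * star (U g) * U g = y := fun g y => by
    simpa [mul_assoc] using congrArg star (h₁ g (star y))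
  have h₂' : ∀ g y, y * U g * star (U g) = y := fun g y => by
    simpa [mul_assoc] using congrArg star (h₂ g (star y))
  -- The cocycle identity rewrites `Θ g (U k)` as `star (U g) * U (g * k)`, a product of two
  -- multipliers.
  have hΘ : ∀ g k, Multiplies (Θ g (U k)) (cstarGen s) (cstarGen s) := fun g k => by
    have e : Θ g (U k) = star (U g) * U (g * k) := by rw [← hmul, h₁]
    intro y hy
    rw [e]
    refine ⟨?_, ?_⟩
    · rw [mul_assoc]
      exact (hU' g _ (hU _ y hy).1).1
    · rw [← mul_assoc]
      exact (hU _ _ (hU' g y hy).2).2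
  refine ⟨fun g => ⟨ambientMultiplier s (U g) (hU g), ?_, ?_⟩, fun g k => ?_, fun g z => ?_⟩
  · rw [star_ambientMultiplier _ (hU' g)]
    exact DoubleCentralizer.ext_incl (fun y => h₁ g y.1) fun y => h₁' g y.1
  · rw [star_ambientMultiplier _ (hU' g)]
    exact DoubleCentralizer.ext_incl (fun y => h₂ g y.1) fun y => h₂' g y.1
  · rw [multiplierMap_ambientMultiplier Θ h g (hU k) (hΘ g k)]
    exact ambientMultiplier_mul (hU g) (hΘ g k) (hU _) (hmul g k)
  · rw [star_ambientMultiplier _ (hU' g)]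
    refine DoubleCentralizer.ext_incl (fun y => ?_) fun y => ?_
    · change (γ g z).1 * y.1 = U g * (Θ g z.1 * (star (U g) * y.1))
      rw [hconj, mul_assoc, mul_assoc]
    · change y.1 * (γ g z).1 = y.1 * U g * Θ g z.1 * star (U g)
      rw [hconj, ← mul_assoc, ← mul_assoc]

end Multipliers

/-! ### Real cocycles -/

section Real

variable {Γ : Type*} [Group Γ]

lemma RealCocycle.isCircleCocycle_twist (ω₀ : RealCocycle Γ) (θ : ℝ) :
    IsCircleCocycle (ω₀.twist θ) where
  cocycle g h k := by
    simp only [RealCocycle.twist, ← Circle.exp_add, ← mul_add, ω₀.cocycle]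
  apply_one g := by simp [RealCocycle.twist, ω₀.apply_one]
  one_apply g := by simp [RealCocycle.twist, ω₀.one_apply]

lemma RealCocycle.isCocycleFamily_twist (ω₀ : RealCocycle Γ) :
    IsCocycleFamily fun t : I => ω₀.twist t where
  cocycle t := ω₀.isCircleCocycle_twist t
  continuous g h := by
    change Continuous fun t : I => Circle.exp ((t : ℝ) * ω₀.toFun g h)
    fun_prop

/-- The restriction of a real cocycle to a finite subgroup is a coboundary. -/
lemma RealCocycle.exists_coboundary (ω₀ : RealCocycle Γ) (H : Subgroup Γ) [Finite H] :
    ∃ ψ : Γ → ℝ, ∀ g h : H, ψ g + ψ h - ψ (g * h : Γ) = ω₀.toFun g h := by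
  have := Fintype.ofFinite H
  -- The primitive is the average of `ω₀(g, ·)` over `H`. Summing the cocycle identity for `g, h, k`
  -- over `k`, with `k ↦ hk` a bijection of `H`, gives the coboundary relation.
  refine ⟨fun g => (∑ k : H, ω₀.toFun g k) / Fintype.card H, fun g h => ?_⟩
  have h0 : (Fintype.card H : ℝ) ≠ 0 := by exact_mod_cast Fintype.card_ne_zero
  have h1 : ∑ k : H, ω₀.toFun g (h * k : Γ) = ∑ k : H, ω₀.toFun g k :=
    Fintype.sum_equiv (Equiv.mulLeft h) _ _ fun k => rfl
  have h2 : ∑ k : H, (ω₀.toFun g h + ω₀.toFun (g * h) k) =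
      ∑ k : H, (ω₀.toFun h k + ω₀.toFun g (h * k : Γ)) :=
    Finset.sum_congr rfl fun k _ => ω₀.cocycle g h k
  rw [Finset.sum_add_distrib, Finset.sum_add_distrib, h1, Finset.sum_const, Finset.card_univ,
    nsmul_eq_mul] at h2
  field_simp
  linarith

end Real

/-! ### The exterior equivalence -/

section ExteriorEquivalence

variable {Γ : Type*} [Group Γ] {A : Type*} [NonUnitalCStarAlgebra A]
  {K : Type*} [NormedAddCommGroup K] [InnerProductSpace ℂ K] [CompleteSpace K]
  {π : A →⋆ₙₐ[ℂ] Op K}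

lemma diagFld_multiplies_crossedProduct {X : Type*} [TopologicalSpace X] [CompactSpace X]
    (hπ : Function.Injective π) (α : Coaction Γ π) {ω : X → Γ → Γ → Circle}
    (hω : IsCocycleFamily ω) (d : X → Γ → Circle) (hd : ∀ s, Continuous fun x => d x s) :
    Multiplies (diagFld K d) (cstarGen (crossedGenerators α ω))
      (cstarGen (crossedGenerators α ω)) := by
  intro y hy
  have h := diagFld_multiplies α d hd _ (fldAd_crossedProduct_mem hπ α hω hy)
  rw [← fldAd_untwistU_diagFld ω d, ← map_mul, ← map_mul] at h
  have h1 := fldAd_symm_matrixFields_mem α hω h.1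
  have h2 := fldAd_symm_matrixFields_mem α hω h.2
  rw [StarAlgEquiv.symm_apply_apply] at h1 h2
  exact ⟨h1, h2⟩

lemma fldConj_rightRep_diagFld {X : Type*} (k : Γ) (d : X → Γ → Circle) :
    fldConj X _ (rightRep Γ _ k) (diagFld K d) = diagFld K fun x s => d x (s * k) := by
  refine Fld.ext fun x => conjHom_eq_iff.2 fun ξ => lp.ext <| funext fun s => ?_
  change rightU k (diagU (fun s => phaseU (d x s)) ξ) s = (d x (s * k) : ℂ) • rightU k ξ s
  rw [rightU_apply, rightU_apply]
  rfl

lemma conjHom_untwistU_rightU {ω : Γ → Γ → Circle} (hω : IsCircleCocycle ω) (k : Γ)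
    (T : Op (Ell2 Γ (Ell2 Γ (Ell2 Γ K)))) :
    conjHom (untwistU K ω) (conjHom (rightU k) T) =
      conjHom (twistedRightU K ω k) (conjHom (untwistU K ω) T) := by
  refine conjHom_eq_iff.2 fun ξ => ?_
  obtain ⟨η, rfl⟩ := (rightU k).surjective ξ
  rw [conjHom_map, untwistU_rightU hω, untwistU_rightU hω, conjHom_map, conjHom_map]

lemma fldAd_untwistU_fldConj {X : Type*} {ω : X → Γ → Γ → Circle}
    (hω : ∀ x, IsCircleCocycle (ω x)) (k : Γ) (T : Fld X (Ell2 Γ (Ell2 Γ (Ell2 Γ K)))) :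
    fldAd (fun x => untwistU K (ω x)) (fldConj X _ (rightRep Γ _ k) T) =
      fldAd (fun x => twistedRightU K (ω x) k) (fldAd (fun x => untwistU K (ω x)) T) :=
  Fld.ext fun x => conjHom_untwistU_rightU (hω x) k (T x)

lemma untwistHom_constantAction (α : Coaction Γ π) {ω : Γ → Γ → Circle} (hω : IsCircleCocycle ω)
    (H : Subgroup Γ) (k : H) (F : C(I, CrossedProduct α fun _ : Unit => ω)) :
    untwistHom I α ω
      (constantAction I ((dualAction α fun _ : Unit => ω).comp H.subtype) k F) =
    fldAd (fun _ => twistedRightU K ω k) (untwistHom I α ω F)  :=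
  Fld.ext fun t => conjHom_untwistU_rightU hω (k : Γ) ((F t).1 ())

lemma conjHom_twistedRightU_matrixOp (ω : Γ → Γ → Circle) (k g s : Γ) (a : A) :
    conjHom (twistedRightU K ω k) (matrixOp π g s a) =
      (((ω (g * (s * k⁻¹)) k)⁻¹ * ω (s * k⁻¹) k : Circle) : ℂ) • matrixOp π g (s * k⁻¹) a :=
  conjHom_eq_iff.2 fun ξ => twistedRightU_matrixOp ω k g s a ξ

lemma conjHom_diagU_matrixOp (d : Γ → Circle) (g s : Γ) (a : A) :
    conjHom (diagU fun s => phaseU (d s)) (matrixOp π g s a) =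
      ((d (g * s) * (d s)⁻¹ : Circle) : ℂ) • matrixOp π g s a := by
  refine conjHom_eq_iff.2 fun ξ => ?_
  change _ = ((d (g * s) * (d s)⁻¹ : Circle) : ℂ) •
    matrixOp π g s a (diagU (fun s => phaseU (d s)) ξ)
  rw [diagU_matrixOp, matrixOp_diagU, smul_smul, ← Circle.coe_mul, inv_mul_cancel_right]

/-- Both sides are `*`-homomorphisms, so they need only agree on generators; there `h` is applied
with `p` the row and `q` the column of the translated matrix unit. -/
lemma fldAd_twistedRightU_eq (α : Coaction Γ π) {ω : Γ → Γ → Circle} {ω' : I → Γ → Γ → Circle}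
    (k : Γ) (d : I → Γ → Circle)
    (h : ∀ t p q, (ω p k)⁻¹ * ω q k = d t p * (d t q)⁻¹ * ((ω' t p k)⁻¹ * ω' t q k))
    {n : Fld I (Ell2 Γ (Ell2 Γ (Ell2 Γ K)))} (hn : n ∈ cstarGen (matrixFields I α)) :
    fldAd (fun _ => twistedRightU K ω k) n =
      diagFld K d * fldAd (fun t => twistedRightU K (ω' t) k) n * star (diagFld K d) := by
  let Ψ : Fld I (Ell2 Γ (Ell2 Γ (Ell2 Γ K))) →⋆ₙₐ[ℂ] Fld I (Ell2 Γ (Ell2 Γ (Ell2 Γ K))) :=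
    fldMap fun _ => conjHom (twistedRightU K ω k)
  let Ψ' : Fld I (Ell2 Γ (Ell2 Γ (Ell2 Γ K))) →⋆ₙₐ[ℂ] Fld I (Ell2 Γ (Ell2 Γ (Ell2 Γ K))) :=
    fldMap fun t => (conjHom (diagU fun s => phaseU (d t s))).comp
      (conjHom (twistedRightU K (ω' t) k))
  have key : ∀ y ∈ matrixFields I α, Ψ y = Ψ' y := by
    rintro _ ⟨g, s, a, f, -, rfl⟩
    refine Fld.ext fun t => ?_
    change conjHom (twistedRightU K ω k) (f t • matrixOp π g s a) =
      conjHom (diagU fun s => phaseU (d t s))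
        (conjHom (twistedRightU K (ω' t) k) (f t • matrixOp π g s a))
    rw [map_smul, map_smul, map_smul, conjHom_twistedRightU_matrixOp,
      conjHom_twistedRightU_matrixOp, map_smul, conjHom_diagU_matrixOp, h t, smul_smul, smul_smul, smul_smul]
    congr 1
    simp only [Circle.coe_mul]
    ring
  refine (eqOn_cstarGen Ψ Ψ' key hn).trans ?_
  rw [star_diagFld]
  rfl

/-- Actions related by a cocycle of diagonal unitaries are exterior equivalent. -/
lemma exteriorEquivalent_of_diagonal (hπ : Function.Injective π) (α : Coaction Γ π)
    {ω : Γ → Γ → Circle} (hω : IsCircleCocycle ω) {ω' : I → Γ → Γ → Circle}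
    (hω' : IsCocycleFamily ω') (H : Subgroup Γ) (d : H → I → Γ → Circle)
    (hd : ∀ k s, Continuous fun t => d k t s)
    (hmul : ∀ k h t s, d k t s * d h t (s * k) = d (k * h) t s)
    (hconj : ∀ (k : H) t p q,
      (ω p k)⁻¹ * ω q k = d k t p * (d k t q)⁻¹ * ((ω' t p k)⁻¹ * ω' t q k)) :
    ExteriorEquivalent ((dualAction α ω').comp H.subtype)
      (transportAction (trivialization hπ α hω hω')
        (constantAction I ((dualAction α fun _ : Unit => ω).comp H.subtype))) := by
  have hU : ∀ d : I → Γ → Circle, (∀ s, Continuous fun t => d t s) →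
      Multiplies (diagFld K d) (cstarGen (crossedGenerators α ω'))
        (cstarGen (crossedGenerators α ω')) :=
    fun d hd => diagFld_multiplies_crossedProduct hπ α hω' d hd
  set φ := trivialization hπ α hω hω' with hφ
  refine exteriorEquivalent_of_ambient
    (((fldConj I _).comp (rightRep Γ (Ell2 Γ (Ell2 Γ K)))).comp H.subtype)
    (fun k => rightU_crossedGenerators α ω' k) _ (fun k => diagFld K (d k))
    (fun k => hU _ (hd k)) (fun k => ?_) (fun k y => ?_) (fun k y => ?_) (fun k h => ?_)
    fun k z => ?_
  · rw [star_diagFld]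
    exact hU _ fun s => (hd k s).inv
  · rw [star_diagFld, ← mul_assoc, diagFld_mul]
    simpa only [inv_mul_cancel] using diagFld_one_mul y
  · rw [star_diagFld, ← mul_assoc, diagFld_mul]
    simpa only [mul_inv_cancel] using diagFld_one_mul y
  · change diagFld K (d k) * fldConj I _ (rightRep Γ _ (k : Γ)) (diagFld K (d h)) = _
    rw [fldConj_rightRep_diagFld, diagFld_mul]
    simp only [hmul]
  · obtain ⟨F, rfl⟩ := EquivLike.surjective φ z
    change (φ (constantAction I ((dualAction α fun _ : Unit => ω).comp H.subtype) k
      (φ.symm (φ F)))).1 = diagFld K (d k) * fldConj I _ (rightRep Γ _ (k : Γ)) (φ F).1 *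
        star (diagFld K (d k))
    rw [StarAlgEquiv.symm_apply_apply]
    -- In the untwisted picture the two actions are explicit, and the diagonal unitaries are
    -- unchanged.
    apply EquivLike.injective (fldAd fun t => untwistU K (ω' t))
    have e1 : ∀ F, fldAd (fun t => untwistU K (ω' t)) (φ F).1 = untwistHom I α ω F :=
      fun F => StarAlgEquiv.apply_symm_apply _ _
    rw [e1, untwistHom_constantAction α hω, map_mul, map_mul, map_star, fldAd_untwistU_diagFld,
      fldAd_untwistU_fldConj hω'.cocycle, e1]
    exact fldAd_twistedRightU_eq α k (d k) (hconj k) (untwistHom_mem hπ α hω F)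

end ExteriorEquivalence

end CoactionDeformation

end

/-! ### The theorem, with the explicit diagonal cocycle -/

open CoactionDeformation in
theorem mainTheorem9
    {Γ : Type*} [Group Γ]
    {A : Type*} [NonUnitalCStarAlgebra A]
    {K : Type*} [NormedAddCommGroup K] [InnerProductSpace ℂ K] [CompleteSpace K]
    (π : A →⋆ₙₐ[ℂ] Op K) (hπ : Function.Injective π)
    (α : Coaction Γ π) (ω₀ : RealCocycle Γ)
    (H : Subgroup Γ) [Finite H] (θ : I) :
    ∃ φ : C(I, CrossedProduct α fun _ : Unit => ω₀.twist θ) ≃⋆ₐ[ℂ]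
        CrossedProduct α fun t : I => ω₀.twist t,
      (∀ (f : C(I, ℂ)) (F : C(I, CrossedProduct α fun _ : Unit => ω₀.twist θ)),
        CStarGen.incl _ (φ (f • F)) = scalarFld f * CStarGen.incl _ (φ F)) ∧
      ExteriorEquivalent
        ((dualAction α fun t : I => ω₀.twist t).comp H.subtype)
        (transportAction φ
          (constantAction I ((dualAction α fun _ : Unit => ω₀.twist θ).comp H.subtype))) := by
  obtain ⟨ψ, hψ⟩ := ω₀.exists_coboundary H
  refine ⟨trivialization hπ α (ω₀.isCircleCocycle_twist θ) ω₀.isCocycleFamily_twist,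
    incl_trivialization_smul hπ α _ _, ?_⟩
  refine exteriorEquivalent_of_diagonal hπ α _ _ H
    -- The term `ω₀(s,k)` accounts for the difference between the phases at `θ` and at `t`. The term
    -- `ψ k` cancels in conjugations, but it makes the cocycle identity exact, since its coboundary
    -- is `ω₀` on `H`.
    (fun k t s => Circle.exp ((θ - t) * (ψ k - ω₀.toFun s k))) (fun k s => by fun_prop)
    (fun k h t s => ?_) fun k t p q => ?_
  · rw [← Circle.exp_add]
    congr 1
    have h1 := ω₀.cocycle s k h
    have h2 := hψ k h
    simp only [Subgroup.coe_mul]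
    linear_combination ((θ : ℝ) - t) * (h2 - h1)
  · simp only [RealCocycle.twist, ← Circle.exp_neg, ← Circle.exp_add]
    congr 1
    ring
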